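/- Let $k,r\ge 1$ be fixed integers. Let $rP_3$ denote the disjoint union of $r$ copies of the three-vertex path. A finite simple graph $G$ is $rP_3$-free if no induced subgraph of $G$ is isomorphic to $rP_3$. A list-$k$-assignment for $G$ is a map $L:V(G)\to 2^{\{1,\dots,k\}}$. An $L$-coloring of $G$ is a map $\varphi:V(G)\to\{1,\dots,k\}$ such that $\varphi(v)\in L(v)$ for every vertex $v$ and $\varphi(u)\ne\varphi(v)$ for every edge $uv$. Then there is an algorithm (a program for a random access machine with unit cost per instruction and words of $O(\log n)$ bits) with the following property. Given an $rP_3$-free graph $G$ on $n\ge 1$ vertices (by its adjacency matrix) and a list-$k$-assignment $L$ for $G$ (by the characteristic vectors of the lists) such that $L(x)\cap L(y)\cap L(z)=\emptyset$ for every three-element set $\{x,y,z\}\subseteq V(G)$ that induces a path in $G$, the algorithm decides in time $O(n^{5/2})$ whether $G$ has an $L$-coloring. The algorithm and the constant in $O(\cdot)$ depend only on $k$ and $r$. -/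

import Mathlib

/-! ## Graphs, lists and list colorings -/

/-- The graph `rP₃`: the disjoint union of `r` copies of the three-vertex path. -/
def rP3 (r : ℕ) : SimpleGraph (Fin r × Fin 3) where
  Adj p q := p.1 = q.1 ∧ (SimpleGraph.pathGraph 3).Adj p.2 q.2
  symm := ⟨fun _ _ h => ⟨h.1.symm, h.2.symm⟩⟩
  loopless := ⟨fun _ h => (SimpleGraph.pathGraph 3).irrefl h.2⟩

/-- `G` is `H`-free: no induced subgraph of `G` is isomorphic to `H`. -/
def IsFree {V W : Type*} (G : SimpleGraph V) (H : SimpleGraph W) : Prop :=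
  ¬ H.IsIndContained G

/-- `G` has an `L`-coloring: a proper coloring that picks the color of every vertex from its list.
A list-`k`-assignment is a map `L : V → Finset (Fin k)`. -/
def Admissible {V : Type*} {k : ℕ} (G : SimpleGraph V) (L : V → Finset (Fin k)) : Prop :=
  ∃ φ : G.Coloring (Fin k), ∀ v, φ v ∈ L v

/-- Whenever `{x, y, z}` induces a three-vertex path, the lists of `x`, `y`, `z` have no common
color. (The isomorphism forces `x`, `y`, `z` to be distinct.) -/
def NoMonochromaticP3 {V : Type*} {k : ℕ} (G : SimpleGraph V) (L : V → Finset (Fin k)) : Prop :=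
  ∀ x y z : V, Nonempty (G.induce {x, y, z} ≃g SimpleGraph.pathGraph 3) →
    L x ∩ L y ∩ L z = ∅

/-! ## A word RAM with unit cost -/

namespace RAM

/-- A state: the registers (a program mentions finitely many of them) and the random-access
memory. -/
@[ext] structure State where
  reg : ℕ → ℕ
  mem : ℕ → ℕ

/-- Elementary instructions. The first argument of all but `store` is the target register. -/
inductive Instr where
  /-- `reg d := c` -/
  | const (d c : ℕ)
  /-- `reg d := reg a` -/
  | copy (d a : ℕ)
  /-- `reg d := reg a + reg b` -/
  | add (d a b : ℕ)
  /-- `reg d := reg a - reg b` (truncated at `0`) -/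
  | sub (d a b : ℕ)
  /-- `reg d := reg a * reg b` -/
  | mul (d a b : ℕ)
  /-- `reg d := mem (reg a)` -/
  | load (d a : ℕ)
  /-- `mem (reg a) := reg b` -/
  | store (a b : ℕ)

/-- The value that an instruction writes. -/
def Instr.value (s : State) : Instr → ℕ
  | const _ c => c
  | copy _ a => s.reg a
  | add _ a b => s.reg a + s.reg b
  | sub _ a b => s.reg a - s.reg b
  | mul _ a b => s.reg a * s.reg b
  | load _ a => s.mem (s.reg a)
  | store _ b => s.reg b

/-- The state after an instruction. -/
def Instr.apply (s : State) (i : Instr) : State :=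
  match i with
  | const d _ | copy d _ | add d _ _ | sub d _ _ | mul d _ _ | load d _ =>
      { s with reg := Function.update s.reg d (i.value s) }
  | store a _ => { s with mem := Function.update s.mem (s.reg a) (i.value s) }

/-- Tests on which a program can branch. -/
inductive Test where
  /-- `reg a < reg b` -/
  | lt (a b : ℕ)
  /-- `reg a = reg b` -/
  | eq (a b : ℕ)

def Test.Holds (s : State) : Test → Prop
  | lt a b => s.reg a < s.reg b
  | eq a b => s.reg a = s.reg b

/-- Programs: finite texts built from instructions by sequencing, branching and loops. -/
inductive Prog where
  | skip
  | instr (i : Instr)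
  | seq (p q : Prog)
  | branch (b : Test) (p q : Prog)
  | loop (b : Test) (p : Prog)

/-- `Exec W p s t s'`: started in the state `s`, the program `p` halts in the state `s'` after
exactly `t` steps, and never writes a value greater than `W`, the largest number that a machine
word holds (a program that tries to do so is stuck and has no halting run). Every elementary
instruction, every `skip` and every evaluation of a test costs one step. -/
inductive Exec (W : ℕ) : Prog → State → ℕ → State → Prop
  | skip (s : State) : Exec W .skip s 1 s
  | instr (i : Instr) (s : State) (h : i.value s ≤ W) : Exec W (.instr i) s 1 (i.apply s)
  | seq {p q : Prog} {s s' s'' : State} {t u : ℕ} (hp : Exec W p s t s') (hq : Exec W q s' u s'') :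
      Exec W (.seq p q) s (t + u) s''
  | branch_true {b : Test} {p : Prog} (q : Prog) {s s' : State} {t : ℕ} (hb : b.Holds s)
      (hp : Exec W p s t s') : Exec W (.branch b p q) s (1 + t) s'
  | branch_false {b : Test} (p : Prog) {q : Prog} {s s' : State} {t : ℕ} (hb : ¬ b.Holds s)
      (hq : Exec W q s t s') : Exec W (.branch b p q) s (1 + t) s'
  | loop_true {b : Test} {p : Prog} {s s' s'' : State} {t u : ℕ} (hb : b.Holds s)
      (hp : Exec W p s t s') (hl : Exec W (.loop b p) s' u s'') :
      Exec W (.loop b p) s (1 + t + u) s''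
  | loop_false {b : Test} (p : Prog) {s : State} (hb : ¬ b.Holds s) : Exec W (.loop b p) s 1 s

/-- The machine is deterministic: the step count and the final state of a halting run are
determined by the program and the initial state. -/
theorem Exec.unique {W : ℕ} {p : Prog} {s s₁ s₂ : State} {t₁ t₂ : ℕ}
    (h₁ : Exec W p s t₁ s₁) (h₂ : Exec W p s t₂ s₂) : t₁ = t₂ ∧ s₁ = s₂ := by
  induction h₁ generalizing t₂ s₂ with
  | skip s => cases h₂; exact ⟨rfl, rfl⟩
  | instr i s h => cases h₂; exact ⟨rfl, rfl⟩
  | seq hp hq ihp ihq =>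
    cases h₂ with
    | seq hp' hq' =>
      obtain ⟨rfl, rfl⟩ := ihp hp'
      obtain ⟨rfl, rfl⟩ := ihq hq'
      exact ⟨rfl, rfl⟩
  | branch_true q hb hp ih =>
    cases h₂ with
    | branch_true _ _ hp' => obtain ⟨rfl, rfl⟩ := ih hp'; exact ⟨rfl, rfl⟩
    | branch_false _ hb' _ => exact absurd hb hb'
  | branch_false p hb hq ih =>
    cases h₂ with
    | branch_true _ hb' _ => exact absurd hb' hb
    | branch_false _ _ hq' => obtain ⟨rfl, rfl⟩ := ih hq'; exact ⟨rfl, rfl⟩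
  | loop_true hb hp hl ihp ihl =>
    cases h₂ with
    | loop_true _ hp' hl' =>
      obtain ⟨rfl, rfl⟩ := ihp hp'
      obtain ⟨rfl, rfl⟩ := ihl hl'
      exact ⟨rfl, rfl⟩
    | loop_false _ hb' => exact absurd hb hb'
  | loop_false p hb =>
    cases h₂ with
    | loop_true hb' _ _ => exact absurd hb' hb
    | loop_false _ _ => exact ⟨rfl, rfl⟩

open Classical in
/-- The initial state for the input `(G, L)`, where `G` has the vertices `0, …, n - 1`: register
`0` holds `n`; the memory holds the adjacency matrix of `G`, row by row, in the cells
`0, …, n² - 1`, followed by the `n × k` incidence matrix of the lists, row by row (row `v` is the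
characteristic vector of `L v`). All other registers and cells are `0`. -/
noncomputable def input {n k : ℕ} (G : SimpleGraph (Fin n)) (L : Fin n → Finset (Fin k)) :
    State where
  reg := fun r => if r = 0 then n else 0
  mem := fun a =>
    if (∃ u v : Fin n, a = u * n + v ∧ G.Adj u v) ∨
        (∃ (v : Fin n) (i : Fin k), a = n * n + (v * k + i) ∧ i ∈ L v)
    then 1 else 0

end RAM

/-! Fix a color c. By the hypothesis on the lists, the vertices whose lists contain c induce a graph
without an induced three-vertex path, that is, a disjoint union of cliques. A proper coloring uses c
at most once in each of these cliques. Conversely, two adjacent vertices with c in both lists lie in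
the same clique. Hence an L-coloring is the same thing as an assignment of distinct slots (color,
clique) to all vertices, where a vertex is offered only the cliques that contain it
(`ListColoring.admissible_iff`). This is a bipartite matching problem in which every vertex has at
most k edges.

The clique of v in color c is named by the successor of its largest vertex, and 0 means that v is
not offered c. All names are found by a scan of k·n·n entries. The matching is built by one
breadth-first search for an augmenting path from each vertex. A search costs O(n) steps for fixed k,
since at most n vertices enter the queue and each has k offers. If a search finds no free slot, its
queue violates Hall's condition (`Search.not_hasTransversal`); otherwise the path is flipped
(`Augmentation.step`), and no vertex loses its color for good. The total is O(n²), which is within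
the required bound.

To run this on the word RAM, arithmetic expressions and array accesses are compiled to instructions
(`exec_compile`), and programs are verified by Hoare-style rules that also bound the running time
(`LeadsIn.loop`, `LeadsIn.forLoop`). -/

/-! ## A small imperative language on top of the word RAM -/

namespace RAM

/-- A view of a machine state: variables, and five families of arrays, where `arr j c a` is the
cell with index `a` of the array of kind `j` and color `c`. -/
structure View where
  var : ℕ → ℕ
  arr : ℕ → ℕ → ℕ → ℕ

/-- Update of a function of two arguments at one point. -/
def update₂ (f : ℕ → ℕ → ℕ) (c a x : ℕ) : ℕ → ℕ → ℕ :=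
  fun c' a' => if c' = c ∧ a' = a then x else f c' a'

@[simp] theorem update₂_self (f : ℕ → ℕ → ℕ) (c a x : ℕ) : update₂ f c a x c a = x := by
  simp [update₂]

theorem update₂_of_ne (f : ℕ → ℕ → ℕ) {c a c' a' : ℕ} (x : ℕ) (h : ¬ (c' = c ∧ a' = a)) :
    update₂ f c a x c' a' = f c' a' := by
  simp only [update₂, if_neg h]

/-- Assignment to a variable. -/
def View.setVar (σ : View) (d x : ℕ) : View := { σ with var := Function.update σ.var d x }

/-- Assignment to an array cell. -/
def View.setArr (σ : View) (j c a x : ℕ) : View :=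
  { σ with arr := Function.update σ.arr j (update₂ (σ.arr j) c a x) }

@[simp] theorem View.setVar_var (σ : View) (d x i : ℕ) :
    (σ.setVar d x).var i = if i = d then x else σ.var i := by
  simp [View.setVar, Function.update_apply]

@[simp] theorem View.setVar_arr (σ : View) (d x : ℕ) : (σ.setVar d x).arr = σ.arr := rfl

@[simp] theorem View.setArr_var (σ : View) (j c a x : ℕ) : (σ.setArr j c a x).var = σ.var := rfl

@[simp] theorem View.setArr_arr (σ : View) (j c a x i : ℕ) :
    (σ.setArr j c a x).arr i = if i = j then update₂ (σ.arr j) c a x else σ.arr i := by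
  simp only [View.setArr, Function.update_apply]

/-- The first cell after the input. -/
def base (n k : ℕ) : ℕ := n * n + n * k

/-- The address of an array cell. -/
def address (n k j c a : ℕ) : ℕ := (a * k + c) * 5 + j + base n k

theorem mul_add_inj {m a b a' b' : ℕ} (hb : b < m) (hb' : b' < m)
    (h : a * m + b = a' * m + b') : a = a' ∧ b = b' := by
  have h3 := congrArg (· % m) h
  simp only [Nat.mul_add_mod', Nat.mod_eq_of_lt hb, Nat.mod_eq_of_lt hb'] at h3
  subst h3
  exact ⟨Nat.eq_of_mul_eq_mul_right (by omega) (by omega : a * m = a' * m), rfl⟩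

theorem address_inj {n k j c a j' c' a' : ℕ} (hj : j < 5) (hj' : j' < 5) (hc : c < k) (hc' : c' < k)
    (h : address n k j c a = address n k j' c' a') : j = j' ∧ c = c' ∧ a = a' := by
  unfold address at h
  have h1 : j = j' := by omega
  have h2 : a * k + c = a' * k + c' := by omega
  exact ⟨h1, (mul_add_inj hc hc' h2).2, (mul_add_inj hc hc' h2).1⟩

/-- The machine state `s` represents the view `σ` and still holds the input `I`. -/
structure Represents (n k : ℕ) (I : ℕ → ℕ) (σ : View) (s : State) : Prop where
  var : ∀ i < 20, s.reg i = σ.var i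
  base : s.reg 20 = base n k
  input : ∀ a < RAM.base n k, s.mem a = I a
  arr : ∀ j < 5, ∀ c < k, ∀ a, s.mem (address n k j c a) = σ.arr j c a

/-- A word size that is large enough for all addresses. -/
def LargeWord (n k W : ℕ) : Prop := address n k 5 k n ≤ W

theorem LargeWord.address_le {n k W j c a : ℕ} (hW : LargeWord n k W) (hj : j < 5) (hc : c < k)
    (ha : a ≤ n) : address n k j c a ≤ W := by
  have := Nat.mul_le_mul_right k ha
  unfold LargeWord address at *
  omega

theorem LargeWord.le_of_le {n k W x : ℕ} (hW : LargeWord n k W)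
    (h : x ≤ (n * k + k) * 5 + 5 + (n * n + n * k)) : x ≤ W := h.trans hW

/-! ### Expressions and the correctness of their compilation. -/

inductive Expr where
  | const (c : ℕ)
  | var (i : ℕ)
  | add (e f : Expr)
  | sub (e f : Expr)
  | mul (e f : Expr)
  | get (j : ℕ) (c a : Expr)
  | input (a : Expr)

namespace Expr

@[simp] def eval (I : ℕ → ℕ) (σ : View) : Expr → ℕ
  | const c => c
  | var i => σ.var i
  | add e f => e.eval I σ + f.eval I σ
  | sub e f => e.eval I σ - f.eval I σ
  | mul e f => e.eval I σ * f.eval I σ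
  | get j c a => σ.arr j (c.eval I σ) (a.eval I σ)
  | input a => I (a.eval I σ)

/-- Evaluation of the expression stays within the arrays and the word size. -/
@[simp] def Safe (n k W : ℕ) (I : ℕ → ℕ) (σ : View) : Expr → Prop
  | const c => c ≤ W
  | var i => i < 20 ∧ σ.var i ≤ W
  | add e f => e.Safe n k W I σ ∧ f.Safe n k W I σ ∧ e.eval I σ + f.eval I σ ≤ W
  | sub e f => e.Safe n k W I σ ∧ f.Safe n k W I σ
  | mul e f => e.Safe n k W I σ ∧ f.Safe n k W I σ ∧ e.eval I σ * f.eval I σ ≤ W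
  | get j c a => c.Safe n k W I σ ∧ a.Safe n k W I σ ∧ j < 5 ∧ c.eval I σ < k ∧ a.eval I σ ≤ n ∧
      σ.arr j (c.eval I σ) (a.eval I σ) ≤ W
  | input a => a.Safe n k W I σ ∧ a.eval I σ < base n k ∧ I (a.eval I σ) ≤ W

theorem Safe.eval_le {n k W : ℕ} {I : ℕ → ℕ} {σ : View} {e : Expr} (h : e.Safe n k W I σ) :
    e.eval I σ ≤ W := by
  induction e with
  | const => exact h
  | var => exact h.2
  | add | mul => exact h.2.2
  | sub e f ihe => exact (Nat.sub_le _ _).trans (ihe h.1)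
  | get => exact h.2.2.2.2.2
  | input => exact h.2.2

/-- Replaces the index in register `d` and the color in register `d + 1` by the address of the
array cell. -/
def addressCode (k j d : ℕ) : Prog :=
  .seq (.instr (.const (d + 2) k)) <| .seq (.instr (.mul d d (d + 2))) <|
  .seq (.instr (.add d d (d + 1))) <| .seq (.instr (.const (d + 2) 5)) <|
  .seq (.instr (.mul d d (d + 2))) <| .seq (.instr (.const (d + 2) j)) <|
  .seq (.instr (.add d d (d + 2))) (.instr (.add d d 20))

/-- Code that leaves the value of an expression in register `d`, and does not change the registers
below `d`. -/
def compile (k : ℕ) : Expr → ℕ → Prog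
  | const c, d => .instr (.const d c)
  | var i, d => .instr (.copy d i)
  | add e f, d => .seq (compile k e d) (.seq (compile k f (d + 1)) (.instr (.add d d (d + 1))))
  | sub e f, d => .seq (compile k e d) (.seq (compile k f (d + 1)) (.instr (.sub d d (d + 1))))
  | mul e f, d => .seq (compile k e d) (.seq (compile k f (d + 1)) (.instr (.mul d d (d + 1))))
  | get j c a, d => .seq (compile k a d)
      (.seq (compile k c (d + 1)) (.seq (addressCode k j d) (.instr (.load d d))))
  | input a, d => .seq (compile k a d) (.instr (.load d d))

end Expr

/-- `s'` differs from `s` only in registers with numbers at least `d`, and holds `x` in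
register `d`. -/
structure Computes (d x : ℕ) (s s' : State) : Prop where
  mem : s'.mem = s.mem
  reg : ∀ i < d, s'.reg i = s.reg i
  val : s'.reg d = x

/-- Registers 0 to 19 hold the variables and register 20 the base address, so scratch work in
registers above 20 leaves the represented view intact. -/
theorem Computes.represents {n k d x : ℕ} {I : ℕ → ℕ} {σ : View} {s s' : State} (hd : 20 < d)
    (h : Computes d x s s') (hs : Represents n k I σ s) : Represents n k I σ s' where
  var i hi := by rw [h.reg i (by omega), hs.var i hi]
  base := by rw [h.reg 20 hd, hs.base]
  input := by rw [h.mem]; exact hs.input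
  arr := by rw [h.mem]; exact hs.arr

theorem exec_addressCode {n k j c a W d : ℕ} (hW : LargeWord n k W) (hj : j < 5) (hc : c < k)
    (ha : a ≤ n) (hd : 20 < d) {s : State} (hb : s.reg 20 = base n k) (h0 : s.reg d = a)
    (h1 : s.reg (d + 1) = c) :
    ∃ t s', Exec W (Expr.addressCode k j d) s t s' ∧ Computes d (address n k j c a) s s' := by
  have hA := hW.address_le hj hc ha
  have hk : k ≤ W := hW.le_of_le (by omega)
  have h5 : 5 ≤ W := hW.le_of_le (by omega)
  unfold address at hA
  have hd' : 20 ≠ d := by omega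
  have hd'' : 20 ≠ d + 2 := by omega
  refine ⟨_, _, .seq (.instr _ _ ?_) <| .seq (.instr _ _ ?_) <| .seq (.instr _ _ ?_) <|
    .seq (.instr _ _ ?_) <| .seq (.instr _ _ ?_) <| .seq (.instr _ _ ?_) <|
    .seq (.instr _ _ ?_) (.instr _ _ ?_), ?_, ?_, ?_⟩
  all_goals simp [Instr.value, Instr.apply, Function.update_apply, h0, h1, hb, hd', hd'']
  any_goals omega
  · intro i hi
    simp [show i ≠ d by omega, show i ≠ d + 2 by omega]
  · rfl

/-- Registers from d on serve as an evaluation stack: a second operand is computed in register d +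
1, which preserves the first one in register d. -/
theorem exec_compile {n k W : ℕ} (hW : LargeWord n k W) {I : ℕ → ℕ} {σ : View} (e : Expr) :
    ∀ {d : ℕ} {s : State}, 20 < d → Represents n k I σ s → e.Safe n k W I σ →
    ∃ t s', Exec W (e.compile k d) s t s' ∧ Computes d (e.eval I σ) s s' := by
  -- The common argument for `add`, `sub` and `mul`, which differ only in the last instruction.
  have binary : ∀ {e f : Expr} {d : ℕ} {s : State} (i : Instr) (x : ℕ), 20 < d →
      Represents n k I σ s → e.Safe n k W I σ → f.Safe n k W I σ →
      (∀ {d : ℕ} {s : State}, 20 < d → Represents n k I σ s → e.Safe n k W I σ →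
        ∃ t s', Exec W (e.compile k d) s t s' ∧ Computes d (e.eval I σ) s s') →
      (∀ {d : ℕ} {s : State}, 20 < d → Represents n k I σ s → f.Safe n k W I σ →
        ∃ t s', Exec W (f.compile k d) s t s' ∧ Computes d (f.eval I σ) s s') →
      (∀ s : State, s.reg d = e.eval I σ → s.reg (d + 1) = f.eval I σ →
        i.value s = x ∧ i.apply s = { s with reg := Function.update s.reg d x }) → x ≤ W →
      ∃ t s', Exec W (.seq (e.compile k d) (.seq (f.compile k (d + 1)) (.instr i))) s t s' ∧
        Computes d x s s' := by
    intro e f d s i x hd hs he hf ihe ihf hi hx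
    obtain ⟨t, s₁, h₁, c₁⟩ := ihe hd hs he
    obtain ⟨u, s₂, h₂, c₂⟩ := ihf (d := d + 1) (by omega) (c₁.represents hd hs) hf
    obtain ⟨h3, h4⟩ := hi s₂ (by rw [c₂.reg d (by omega), c₁.val]) c₂.val
    refine ⟨_, _, .seq h₁ (.seq h₂ (.instr i _ (h3.trans_le hx))), ?_, ?_, ?_⟩
    · rw [h4]; exact c₂.mem.trans c₁.mem
    · intro i hi
      rw [h4]
      simp only [Function.update_apply, if_neg hi.ne]
      rw [c₂.reg i (by omega), c₁.reg i hi]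
    · rw [h4]; simp
  induction e with
  | const c =>
    intro d s hd hs h
    exact ⟨_, _, .instr _ _ h, rfl, fun i hi => by simp [Instr.apply, hi.ne],
      by simp [Instr.apply, Instr.value]⟩
  | var i =>
    intro d s hd hs h
    obtain ⟨h1, h2⟩ := h
    exact ⟨_, _, .instr _ _ (by simpa [Instr.value, hs.var i h1] using h2), rfl,
      fun i hi => by simp [Instr.apply, hi.ne],
      by simp [Instr.apply, Instr.value, hs.var i h1]⟩
  | add e f ihe ihf =>
    intro d s hd hs ⟨he, hf, hx⟩
    exact binary _ _ hd hs he hf ihe ihf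
      (fun s h0 h1 => by simp [Instr.value, Instr.apply, h0, h1]) hx
  | sub e f ihe ihf =>
    intro d s hd hs ⟨he, hf⟩
    exact binary _ _ hd hs he hf ihe ihf
      (fun s h0 h1 => by simp [Instr.value, Instr.apply, h0, h1]) ((Nat.sub_le _ _).trans he.eval_le)
  | mul e f ihe ihf =>
    intro d s hd hs ⟨he, hf, hx⟩
    exact binary _ _ hd hs he hf ihe ihf
      (fun s h0 h1 => by simp [Instr.value, Instr.apply, h0, h1]) hx
  | get j c a ihc iha =>
    intro d s hd hs ⟨hc, ha, hj, hck, han, hx⟩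
    obtain ⟨t, s₁, h₁, c₁⟩ := iha hd hs ha
    have r₁ := c₁.represents hd hs
    obtain ⟨u, s₂, h₂, c₂⟩ := ihc (d := d + 1) (by omega) r₁ hc
    have r₂ := c₂.represents (by omega) r₁
    obtain ⟨v, s₃, h₃, c₃⟩ := exec_addressCode hW hj hck han hd r₂.base
      (by rw [c₂.reg d (by omega), c₁.val]) c₂.val
    have r₃ := c₃.represents hd r₂
    have hv : s₃.mem (s₃.reg d) = σ.arr j (c.eval I σ) (a.eval I σ) := by
      rw [c₃.val, r₃.arr j hj _ hck]
    refine ⟨_, _, .seq h₁ (.seq h₂ (.seq h₃ (.instr _ _ (hv.trans_le hx)))), ?_, ?_, ?_⟩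
    · exact c₃.mem.trans (c₂.mem.trans c₁.mem)
    · intro i hi
      simp only [Instr.apply, Function.update_apply, if_neg hi.ne]
      rw [c₃.reg i hi, c₂.reg i (by omega), c₁.reg i hi]
    · simp [Instr.apply, Instr.value, hv]
  | input a iha =>
    intro d s hd hs ⟨ha, hb, hx⟩
    obtain ⟨t, s₁, h₁, c₁⟩ := iha hd hs ha
    have r₁ := c₁.represents hd hs
    have hv : s₁.mem (s₁.reg d) = I (a.eval I σ) := by rw [c₁.val, r₁.input _ hb]
    refine ⟨_, _, .seq h₁ (.instr _ _ (hv.trans_le hx)), c₁.mem, ?_, ?_⟩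
    · intro i hi
      simp only [Instr.apply, Function.update_apply, if_neg hi.ne]
      rw [c₁.reg i hi]
    · simp [Instr.apply, Instr.value, hv]

/-! ### Statements -/

/-- `var d := e` -/
def setVar (k d : ℕ) (e : Expr) : Prog := .seq (e.compile k 21) (.instr (.copy d 21))

/-- `arr j c a := e` -/
def setArr (k j : ℕ) (c a e : Expr) : Prog :=
  .seq (a.compile k 21) <| .seq (c.compile k 22) <| .seq (Expr.addressCode k j 21) <|
  .seq (e.compile k 22) (.instr (.store 21 22))

/-- `for var d := 0 to var b - 1 do p` -/
def forLoop (k d b : ℕ) (p : Prog) : Prog :=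
  .seq (setVar k d (.const 0))
    (.loop (.lt d b) (.seq p (setVar k d (.add (.var d) (.const 1)))))

@[simp] def Prog.LoopFree : Prog → Prop
  | .skip => True
  | .instr _ => True
  | .seq p q => p.LoopFree ∧ q.LoopFree
  | .branch _ p q => p.LoopFree ∧ q.LoopFree
  | .loop _ _ => False

/-- A bound for the running time of loop-free programs. -/
def Prog.cost : Prog → ℕ
  | .skip => 1
  | .instr _ => 1
  | .seq p q => p.cost + q.cost
  | .branch _ p q => 1 + (p.cost + q.cost)
  | .loop _ _ => 0

theorem Exec.le_cost {W t : ℕ} {p : Prog} {s s' : State} (h : Exec W p s t s') (hp : p.LoopFree) :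
    t ≤ p.cost := by
  induction h with
  | skip | instr => exact le_rfl
  | seq _ _ ih ih' => exact Nat.add_le_add (ih hp.1) (ih' hp.2)
  | branch_true _ _ _ ih => have := ih hp.1; simp only [Prog.cost]; omega
  | branch_false _ _ _ ih => have := ih hp.2; simp only [Prog.cost]; omega
  | loop_true | loop_false => exact hp.elim

theorem loopFree_compile (k : ℕ) (e : Expr) : ∀ d, (e.compile k d).LoopFree := by
  induction e <;> intro d <;> simp_all [Expr.compile, Expr.addressCode]

@[simp] theorem loopFree_setVar (k d : ℕ) (e : Expr) : (setVar k d e).LoopFree :=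
  ⟨loopFree_compile k e _, trivial⟩

@[simp] theorem loopFree_setArr (k j : ℕ) (c a e : Expr) : (setArr k j c a e).LoopFree := by
  simp [setArr, loopFree_compile, Expr.addressCode]

/-! ### Weakest preconditions with running times -/

/-- From a state represented by `σ`, the program halts in a state that is represented by a view
with the property `Q`. -/
def Leads (n k W : ℕ) (I : ℕ → ℕ) (p : Prog) (Q : View → Prop) (σ : View) : Prop :=
  ∀ s, Represents n k I σ s → ∃ t s' σ', Exec W p s t s' ∧ Represents n k I σ' s' ∧ Q σ'

/-- As `Leads`, within `T` steps. -/
def LeadsIn (n k W : ℕ) (I : ℕ → ℕ) (T : ℕ) (p : Prog) (Q : View → Prop) (σ : View) : Prop :=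
  ∀ s, Represents n k I σ s →
    ∃ t s' σ', Exec W p s t s' ∧ t ≤ T ∧ Represents n k I σ' s' ∧ Q σ'

section Rules

variable {n k W : ℕ} {I : ℕ → ℕ} {p q : Prog} {Q R : View → Prop} {σ : View}

/-- The time of loop-free code is bounded by a constant read off its text, so time needs to be
tracked only where loops are involved. -/
theorem Leads.leadsIn (hp : p.LoopFree) (h : Leads n k W I p Q σ) :
    LeadsIn n k W I p.cost p Q σ := by
  intro s hs
  obtain ⟨t, s', σ', h1, h2⟩ := h s hs
  exact ⟨t, s', σ', h1, h1.le_cost hp, h2⟩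

theorem LeadsIn.mono {T T' : ℕ} (hT : T ≤ T') (hQ : ∀ σ, Q σ → R σ)
    (h : LeadsIn n k W I T p Q σ) : LeadsIn n k W I T' p R σ := by
  intro s hs
  obtain ⟨t, s', σ', h1, h2, h3, h4⟩ := h s hs
  exact ⟨t, s', σ', h1, h2.trans hT, h3, hQ _ h4⟩

theorem Leads.skip (h : Q σ) : Leads n k W I .skip Q σ :=
  fun s hs => ⟨_, s, σ, .skip s, hs, h⟩

theorem Leads.seq (h : Leads n k W I p (Leads n k W I q Q) σ) : Leads n k W I (.seq p q) Q σ := by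
  intro s hs
  obtain ⟨t, s₁, σ₁, h1, h2, h3⟩ := h s hs
  obtain ⟨u, s₂, σ₂, h4, h5⟩ := h3 s₁ h2
  exact ⟨_, s₂, σ₂, .seq h1 h4, h5⟩

theorem LeadsIn.seq {T U : ℕ} (h : LeadsIn n k W I T p (LeadsIn n k W I U q Q) σ) :
    LeadsIn n k W I (T + U) (.seq p q) Q σ := by
  intro s hs
  obtain ⟨t, s₁, σ₁, h1, h1', h2, h3⟩ := h s hs
  obtain ⟨u, s₂, σ₂, h4, h4', h5⟩ := h3 s₁ h2
  exact ⟨_, s₂, σ₂, .seq h1 h4, by omega, h5⟩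

theorem Leads.setVar (hW : LargeWord n k W) {d : ℕ} {e : Expr} (hd : d < 20)
    (he : e.Safe n k W I σ) (h : Q (σ.setVar d (e.eval I σ))) :
    Leads n k W I (setVar k d e) Q σ := by
  intro s hs
  obtain ⟨t, s₁, h₁, c₁⟩ := exec_compile hW e (d := 21) (by omega) hs he
  have r₁ := c₁.represents (by omega) hs
  refine ⟨_, _, σ.setVar d (e.eval I σ), .seq h₁ (.instr _ _ ?_), ⟨?_, ?_, r₁.input, r₁.arr⟩, h⟩
  · simpa [Instr.value, c₁.val] using he.eval_le
  · intro i hi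
    simp only [Instr.apply, Function.update_apply, View.setVar_var, Instr.value, c₁.val]
    rw [r₁.var i hi]
  · simpa [Instr.apply, Function.update_apply, hd.ne'] using r₁.base

theorem Leads.setArr (hW : LargeWord n k W) {j : ℕ} {c a e : Expr} (hj : j < 5)
    (hc : c.Safe n k W I σ) (ha : a.Safe n k W I σ) (he : e.Safe n k W I σ)
    (hck : c.eval I σ < k) (han : a.eval I σ ≤ n)
    (h : Q (σ.setArr j (c.eval I σ) (a.eval I σ) (e.eval I σ))) :
    Leads n k W I (setArr k j c a e) Q σ := by
  intro s hs
  obtain ⟨t, s₁, h₁, c₁⟩ := exec_compile hW a (d := 21) (by omega) hs ha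
  have r₁ := c₁.represents (by omega) hs
  obtain ⟨u, s₂, h₂, c₂⟩ := exec_compile hW c (d := 22) (by omega) r₁ hc
  have r₂ := c₂.represents (by omega) r₁
  obtain ⟨v, s₃, h₃, c₃⟩ := exec_addressCode hW hj hck han (by omega : 20 < 21) r₂.base
    (by rw [c₂.reg 21 (by omega), c₁.val]) c₂.val
  have r₃ := c₃.represents (by omega) r₂
  obtain ⟨w, s₄, h₄, c₄⟩ := exec_compile hW e (d := 22) (by omega) r₃ he
  have r₄ := c₄.represents (by omega) r₃
  have hA : s₄.reg 21 = address n k j (c.eval I σ) (a.eval I σ) := by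
    rw [c₄.reg 21 (by omega), c₃.val]
  refine ⟨_, _, σ.setArr j (c.eval I σ) (a.eval I σ) (e.eval I σ),
    .seq h₁ (.seq h₂ (.seq h₃ (.seq h₄ (.instr _ _ ?_)))), ⟨r₄.var, r₄.base, ?_, ?_⟩, h⟩
  · simpa [Instr.value, c₄.val] using he.eval_le
  · intro b hb
    have : b ≠ address n k j (c.eval I σ) (a.eval I σ) := by
      unfold address
      omega
    simp only [Instr.apply, Function.update_apply, hA, if_neg this]
    exact r₄.input b hb
  · intro j' hj' c' hc' a'
    simp only [Instr.apply, Function.update_apply, hA, View.setArr_arr, Instr.value, c₄.val]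
    by_cases hh : address n k j' c' a' = address n k j (c.eval I σ) (a.eval I σ)
    · obtain ⟨rfl, rfl, rfl⟩ := address_inj hj' hj hc' hck hh
      simp
    · rw [if_neg hh, r₄.arr j' hj' c' hc' a']
      by_cases hj'' : j' = j
      · subst hj''
        rw [if_pos rfl, update₂_of_ne]
        rintro ⟨rfl, rfl⟩
        exact hh rfl
      · rw [if_neg hj'']

theorem Leads.branch {a b : ℕ} (ha : a < 20) (hb : b < 20)
    (h1 : σ.var a = σ.var b → Leads n k W I p Q σ) (h2 : σ.var a ≠ σ.var b → Leads n k W I q Q σ) :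
    Leads n k W I (.branch (.eq a b) p q) Q σ := by
  intro s hs
  by_cases h : σ.var a = σ.var b
  · obtain ⟨t, s₁, σ₁, h3, h4⟩ := h1 h s hs
    exact ⟨_, s₁, σ₁, .branch_true _ (by simpa [Test.Holds, hs.var _ ha, hs.var _ hb]) h3, h4⟩
  · obtain ⟨t, s₁, σ₁, h3, h4⟩ := h2 h s hs
    exact ⟨_, s₁, σ₁, .branch_false _ (by simpa [Test.Holds, hs.var _ ha, hs.var _ hb]) h3, h4⟩

theorem LeadsIn.branch {a b T U : ℕ} (ha : a < 20) (hb : b < 20)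
    (h1 : σ.var a = σ.var b → LeadsIn n k W I T p Q σ)
    (h2 : σ.var a ≠ σ.var b → LeadsIn n k W I U q Q σ) :
    LeadsIn n k W I (1 + (T + U)) (.branch (.eq a b) p q) Q σ := by
  intro s hs
  by_cases h : σ.var a = σ.var b
  · obtain ⟨t, s₁, σ₁, h3, h3', h4⟩ := h1 h s hs
    exact ⟨_, s₁, σ₁, .branch_true _ (by simpa [Test.Holds, hs.var _ ha, hs.var _ hb]) h3,
      by omega, h4⟩
  · obtain ⟨t, s₁, σ₁, h3, h3', h4⟩ := h2 h s hs
    exact ⟨_, s₁, σ₁, .branch_false _ (by simpa [Test.Holds, hs.var _ ha, hs.var _ hb]) h3,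
      by omega, h4⟩

/-- The rule for loops, with an invariant `J` that carries a bound for the number of iterations
left. -/
theorem LeadsIn.loop {a b T : ℕ} (ha : a < 20) (hb : b < 20) (J : ℕ → View → Prop)
    (hbody : ∀ m σ, J m σ → σ.var a < σ.var b → ∃ m', m = m' + 1 ∧ LeadsIn n k W I T p (J m') σ)
    (hend : ∀ m σ, J m σ → ¬ σ.var a < σ.var b → Q σ) (m : ℕ) (hσ : J m σ) :
    LeadsIn n k W I (m * (T + 1) + 1) (.loop (.lt a b) p) Q σ := by
  intro s hs
  induction m generalizing σ s with
  | zero =>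
    have h : ¬ σ.var a < σ.var b := fun h => by
      obtain ⟨m', h', -⟩ := hbody 0 σ hσ h
      omega
    exact ⟨1, s, σ, .loop_false _ (by simpa [Test.Holds, hs.var _ ha, hs.var _ hb] using h),
      by omega, hs, hend _ σ hσ h⟩
  | succ m ih =>
    by_cases h : σ.var a < σ.var b
    · obtain ⟨m', h', h1⟩ := hbody _ σ hσ h
      obtain rfl : m = m' := by omega
      obtain ⟨t, s₁, σ₁, h2, h3, h4, h5⟩ := h1 s hs
      obtain ⟨u, s₂, σ₂, h6, h7, h8, h9⟩ := ih h5 s₁ h4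
      refine ⟨_, s₂, σ₂, .loop_true (by simpa [Test.Holds, hs.var _ ha, hs.var _ hb] using h) h2 h6,
        ?_, h8, h9⟩
      rw [Nat.succ_mul]
      omega
    · exact ⟨1, s, σ, .loop_false _ (by simpa [Test.Holds, hs.var _ ha, hs.var _ hb] using h),
        by omega, hs, hend _ σ hσ h⟩

/-- The running time of a counting loop. -/
def forCost (k d m T : ℕ) : ℕ :=
  (setVar k d (.const 0)).cost +
    (m * (T + (setVar k d (.add (.var d) (.const 1))).cost + 1) + 1)

/-- `J i` describes the state at the start of round i, with the counter already at i; this is why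
the body must establish `J (i + 1)` for the view after the increment. -/
theorem LeadsIn.forLoop (hW : LargeWord n k W) {d b m T : ℕ} (hd : d < 20) (hb : b < 20)
    (hm : m ≤ W) (J : ℕ → View → Prop) (hJb : ∀ i σ, J i σ → σ.var b = m)
    (hbody : ∀ i σ, i < m → J i σ → σ.var d = i →
      LeadsIn n k W I T p (fun σ' => σ'.var d = i ∧ J (i + 1) (σ'.setVar d (i + 1))) σ)
    (hend : ∀ σ, J m σ → Q σ) (hσ : J 0 (σ.setVar d 0)) :
    LeadsIn n k W I (forCost k d m T) (forLoop k d b p) Q σ := by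
  refine LeadsIn.seq (Leads.leadsIn (loopFree_setVar _ _ _)
    (Leads.setVar hW hd (Nat.zero_le _) ?_))
  -- The number l of rounds left is tied to the counter by an equation, which avoids truncated
  -- subtraction.
  refine LeadsIn.loop hd hb (fun l σ => σ.var d + l = m ∧ J (σ.var d) σ) ?_ ?_ m
    ⟨by simp, by simpa using hσ⟩
  · rintro l σ ⟨hl, hJ⟩ hlt
    rw [hJb _ _ hJ] at hlt
    obtain ⟨l', rfl⟩ : ∃ l', l = l' + 1 := ⟨l - 1, by omega⟩
    refine ⟨l', rfl, LeadsIn.seq ((hbody _ σ hlt hJ rfl).mono le_rfl ?_)⟩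
    rintro τ ⟨h1, h2⟩
    refine Leads.leadsIn (loopFree_setVar _ _ _)
      (Leads.setVar hW hd ⟨⟨hd, by omega⟩, by simp; omega, by simp; omega⟩ ?_)
    simp only [Expr.eval, h1, View.setVar_var, if_true]
    exact ⟨by omega, h2⟩
  · rintro l σ ⟨hl, hJ⟩ hlt
    rw [hJb _ _ hJ] at hlt
    obtain rfl : l = 0 := by omega
    simp only [Nat.add_zero] at hl
    rw [hl] at hJ
    exact hend _ hJ

end Rules

end RAM

/-! ## Transversals by augmenting paths

The vertices `0, …, n - 1` have to be assigned distinct slots. For every color `c < k` the vertex `x`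
is offered the slot `(c, E c x)`, where the value `E c x = 0` means no offer. -/

namespace Transversal

open RAM (update₂ update₂_self update₂_of_ne)

/-- All vertices can be assigned distinct slots. -/
def HasTransversal (n k : ℕ) (E : ℕ → ℕ → ℕ) : Prop :=
  ∃ f : ℕ → ℕ, (∀ x < n, f x < k ∧ E (f x) x ≠ 0) ∧
    ∀ x < n, ∀ y < n, f x = f y → E (f x) x = E (f y) y → x = y

/-- A partial assignment of slots: `col x = c + 1` if `x` has the slot of color `c`, and `own c u` is
the successor of the vertex that has the slot `(c, u)`. If `cc = c + 1`, then the entry of `own` for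
the slot `(c, fu)` is out of date, and the slot is free. -/
structure PartialAssignment (n k : ℕ) (E own : ℕ → ℕ → ℕ) (col : ℕ → ℕ) (cc fu : ℕ) : Prop where
  color : ∀ x < n, ∀ c, col x = c + 1 → c < k ∧ E c x ≠ 0 ∧ own c (E c x) = x + 1
  owner : ∀ c < k, ∀ u ≤ n, ¬ (c + 1 = cc ∧ u = fu) → ∀ x, own c u = x + 1 →
    x < n ∧ col x = c + 1 ∧ E c x = u
  free : ∀ c, cc = c + 1 → ∀ x < n, col x = c + 1 → E c x ≠ fu

theorem PartialAssignment.of_zero {n k : ℕ} {E own : ℕ → ℕ → ℕ} {col : ℕ → ℕ} {fu : ℕ} (fu' : ℕ)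
    (h : PartialAssignment n k E own col 0 fu) : PartialAssignment n k E own col 0 fu' :=
  ⟨h.color, fun c hc u hu _ => h.owner c hc u hu (by omega), fun _ h => by omega⟩

theorem PartialAssignment.col_le {n k : ℕ} {E own : ℕ → ℕ → ℕ} {col : ℕ → ℕ} {cc fu x : ℕ}
    (h : PartialAssignment n k E own col cc fu) (hx : x < n) : col x ≤ k := by
  by_contra hc
  have := (h.color x hx (col x - 1) (by omega)).1
  omega

theorem PartialAssignment.own_le {n k : ℕ} {E own : ℕ → ℕ → ℕ} {col : ℕ → ℕ} {fu c u : ℕ}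
    (h : PartialAssignment n k E own col 0 fu) (hc : c < k) (hu : u ≤ n) : own c u ≤ n := by
  by_contra ho
  have := (h.owner c hc u hu (by omega) (own c u - 1) (by omega)).1
  omega

/-- The table `own` recovers a vertex from its slot, so no slot is used twice. -/
theorem PartialAssignment.hasTransversal {n k : ℕ} {E own : ℕ → ℕ → ℕ} {col : ℕ → ℕ} {cc fu : ℕ}
    (h : PartialAssignment n k E own col cc fu) (hcol : ∀ x < n, col x ≠ 0) :
    HasTransversal n k E := by
  have key : ∀ x < n, col x = (col x - 1) + 1 := fun x hx => by have := hcol x hx; omega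
  refine ⟨fun x => col x - 1, fun x hx => ?_, fun x hx y hy h1 h2 => ?_⟩
  · have := h.color x hx _ (key x hx)
    exact ⟨this.1, this.2.1⟩
  · have h3 := (h.color x hx _ (key x hx)).2.2
    have h4 := (h.color y hy _ (key y hy)).2.2
    simp only at h1 h2
    rw [h2, h1, h4] at h3
    omega

/-- The state of a breadth-first search for an augmenting path from the vertex `ρ`. The queue holds
`q 0, …, q (tail - 1)`, and `par c u` is the successor of the vertex from which the slot `(c, u)` was
reached. The offers to `q p` for `p < h`, and those to `q h` of color less than `i`, have been
examined. If `cc = c + 1`, then the search has reached the free slot `(c, fu)`. -/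
structure Search (n k : ℕ) (E own : ℕ → ℕ → ℕ) (col : ℕ → ℕ) (ρ : ℕ) (q : ℕ → ℕ)
    (par : ℕ → ℕ → ℕ) (tail cc fu h i : ℕ) : Prop where
  tail_pos : 0 < tail
  root : q 0 = ρ
  lt : ∀ p < tail, q p < n
  inj : ∀ p < tail, ∀ p' < tail, q p = q p' → p = p'
  reached : ∀ p < tail, 0 < p → ∃ c p', col (q p) = c + 1 ∧ p' < p ∧ par c (E c (q p)) = q p' + 1
  parent : ∀ c < k, ∀ u ≤ n, par c u ≠ 0 → ∃ p < tail, par c u = q p + 1 ∧ E c (q p) = u ∧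
    u ≠ 0
  pushed : ∀ c < k, ∀ u ≤ n, par c u ≠ 0 → own c u ≠ 0 → ∃ p < tail, own c u = q p + 1
  owned : cc = 0 → ∀ c < k, ∀ u ≤ n, par c u ≠ 0 → own c u ≠ 0
  found : cc ≠ 0 → ∃ c < k, cc = c + 1 ∧ fu ≤ n ∧ own c fu = 0 ∧ par c fu ≠ 0
  examined : ∀ p < tail, ∀ c < k, (p < h ∨ (p = h ∧ c < i)) → E c (q p) ≠ 0 →
    par c (E c (q p)) ≠ 0

/-! ### Breadth-first search for an augmenting path. -/

namespace Search

variable {n k : ℕ} {E own : ℕ → ℕ → ℕ} {col : ℕ → ℕ} {ρ : ℕ} {q : ℕ → ℕ}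
    {par : ℕ → ℕ → ℕ} {tail cc fu h i : ℕ}

theorem start (fu : ℕ) (hρ : ρ < n) (hq : q 0 = ρ) (hpar : ∀ c < k, ∀ u ≤ n, par c u = 0) :
    Search n k E own col ρ q par 1 0 fu 0 0 where
  tail_pos := one_pos
  root := hq
  lt p hp := by obtain rfl : p = 0 := by omega
                omega
  inj p hp p' hp' _ := by omega
  reached p hp h := by omega
  parent c hc u hu h := absurd (hpar c hc u hu) h
  pushed c hc u hu h := absurd (hpar c hc u hu) h
  owned _ c hc u hu h := absurd (hpar c hc u hu) h
  found h := absurd rfl h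
  examined p _ c _ h := by omega

theorem next (S : Search n k E own col ρ q par tail cc fu h k) :
    Search n k E own col ρ q par tail cc fu (h + 1) 0 :=
  { S with examined := fun p hp c hc h' => S.examined p hp c hc (by omega) }

/-- The queue has no repetitions. This bounds both the number of rounds of the search and the queue
indices. -/
theorem tail_le (S : Search n k E own col ρ q par tail cc fu h i) : tail ≤ n := by
  have := Finset.card_le_card_of_injOn (s := Finset.range tail) (t := Finset.range n) q
    (fun p hp => by simpa using S.lt p (by simpa using hp))
    (fun p hp p' hp' e => S.inj p (by simpa using hp) p' (by simpa using hp') e)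
  simpa using this

theorem par_le (S : Search n k E own col ρ q par tail cc fu h i) {c u : ℕ} (hc : c < k)
    (hu : u ≤ n) : par c u ≤ n := by
  by_contra ho
  obtain ⟨p, hp, h1, -⟩ := S.parent c hc u hu (by omega)
  have := S.lt p hp
  omega

/-- Covers both uneventful cases: there is no offer, or the offered slot has been reached before. -/
theorem examine_old (S : Search n k E own col ρ q par tail cc fu h i)
    (hx : E i (q h) ≠ 0 → par i (E i (q h)) ≠ 0) :
    Search n k E own col ρ q par tail cc fu h (i + 1) :=
  { S with
    examined := fun p hp c hc h' => by
      by_cases hpc : p = h ∧ c = i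
      · obtain ⟨rfl, rfl⟩ := hpc
        exact hx
      · exact S.examined p hp c hc (by omega) }

/-- The search reaches a free slot. -/
theorem examine_free (S : Search n k E own col ρ q par tail cc fu h i) (hh : h < tail) (hi : i < k)
    (hE : E i (q h) ≤ n) (hE0 : E i (q h) ≠ 0)
    (hpar : par i (E i (q h)) = 0) (hown : own i (E i (q h)) = 0) :
    Search n k E own col ρ q (update₂ par i (E i (q h)) (q h + 1)) tail (i + 1) (E i (q h)) h
      (i + 1) := by
  have hne : ∀ c u, par c u ≠ 0 → update₂ par i (E i (q h)) (q h + 1) c u = par c u := by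
    intro c u hcu
    refine update₂_of_ne _ _ ?_
    rintro ⟨rfl, rfl⟩
    exact hcu hpar
  have hpos : ∀ c u, par c u ≠ 0 → update₂ par i (E i (q h)) (q h + 1) c u ≠ 0 := by
    intro c u hcu
    rwa [hne c u hcu]
  refine { S with
    reached := ?_, parent := ?_, pushed := ?_, owned := ?_, found := ?_, examined := ?_ }
  · intro p hp hp0
    obtain ⟨c, p', h1, h2, h3⟩ := S.reached p hp hp0
    exact ⟨c, p', h1, h2, by rw [hne _ _ (by omega), h3]⟩
  · intro c hc u hu hcu
    by_cases hcu' : c = i ∧ u = E i (q h)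
    · obtain ⟨rfl, rfl⟩ := hcu'
      exact ⟨h, hh, by simp, rfl, hE0⟩
    · rw [update₂_of_ne _ _ hcu'] at hcu ⊢
      exact S.parent c hc u hu hcu
  · intro c hc u hu hcu ho
    by_cases hcu' : c = i ∧ u = E i (q h)
    · obtain ⟨rfl, rfl⟩ := hcu'
      exact absurd hown ho
    · rw [update₂_of_ne _ _ hcu'] at hcu
      exact S.pushed c hc u hu hcu ho
  · intro h0
    omega
  · intro _
    exact ⟨i, hi, rfl, hE, hown, by simp⟩
  · intro p hp c hc h' hne'
    by_cases hpc : p = h ∧ c = i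
    · obtain ⟨rfl, rfl⟩ := hpc
      simp
    · exact hpos _ _ (S.examined p hp c hc (by omega) hne')

/-- The search reaches the slot of the vertex `w`, which joins the queue. -/
theorem examine_owned (hM : PartialAssignment n k E own col 0 0) (hρ : col ρ = 0)
    (S : Search n k E own col ρ q par tail cc fu h i) (hh : h < tail) (hi : i < k)
    (hE : E i (q h) ≤ n) (hE0 : E i (q h) ≠ 0)
    (hpar : par i (E i (q h)) = 0) {w : ℕ} (hown : own i (E i (q h)) = w + 1)
    {q' : ℕ → ℕ} (hq' : q' tail = w) (hq : ∀ p ≠ tail, q' p = q p) :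
    Search n k E own col ρ q' (update₂ par i (E i (q h)) (q h + 1)) (tail + 1) cc fu h
      (i + 1) := by
  obtain ⟨hwn, hwc, hwE⟩ := hM.owner i hi _ hE (by omega) w hown
  have hne : ∀ c u, par c u ≠ 0 → update₂ par i (E i (q h)) (q h + 1) c u = par c u := by
    intro c u hcu
    refine update₂_of_ne _ _ ?_
    rintro ⟨rfl, rfl⟩
    exact hcu hpar
  have hq2 : ∀ p < tail, q' p = q p := fun p hp => hq p hp.ne
  -- The owner w is new to the queue: the root has no color, and any other queued vertex entered
  -- through its own slot, which would then already have a parent.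
  have hnew : ∀ p < tail, q p ≠ w := by
    intro p hp hpw
    rcases Nat.eq_zero_or_pos p with rfl | hp0
    · rw [S.root] at hpw
      rw [hpw] at hρ
      omega
    · obtain ⟨c, p', h1, h2, h3⟩ := S.reached p hp hp0
      rw [hpw] at h1 h3
      obtain rfl : c = i := by omega
      rw [hwE] at h3
      omega
  have hcases : ∀ p < tail + 1, p < tail ∨ p = tail := fun p hp => by omega
  constructor
  · exact Nat.succ_pos _
  · rw [hq2 0 S.tail_pos, S.root]
  · intro p hp
    rcases hcases p hp with hp | rfl
    · rw [hq2 p hp]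
      exact S.lt p hp
    · rwa [hq']
  · intro p hp p' hp' e
    rcases hcases p hp with hp | rfl <;> rcases hcases p' hp' with hp' | rfl
    · rw [hq2 p hp, hq2 p' hp'] at e
      exact S.inj p hp p' hp' e
    · rw [hq2 p hp, hq'] at e
      exact absurd e (hnew p hp)
    · rw [hq2 p' hp', hq'] at e
      exact absurd e.symm (hnew p' hp')
    · rfl
  · intro p hp hp0
    rcases hcases p hp with hp | rfl
    · obtain ⟨c, p', h1, h2, h3⟩ := S.reached p hp hp0
      refine ⟨c, p', by rw [hq2 p hp, h1], h2, ?_⟩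
      rw [hq2 p hp, hq2 p' (by omega), hne _ _ (by omega), h3]
    · exact ⟨i, h, by rw [hq', hwc], hh, by rw [hq', hwE, update₂_self, hq2 h hh]⟩
  · intro c hc u hu hcu
    by_cases hcu' : c = i ∧ u = E i (q h)
    · obtain ⟨rfl, rfl⟩ := hcu'
      exact ⟨h, by omega, by simp [hq2 h hh], by rw [hq2 h hh], hE0⟩
    · rw [update₂_of_ne _ _ hcu'] at hcu ⊢
      obtain ⟨p, hp, h1, h2, h3⟩ := S.parent c hc u hu hcu
      exact ⟨p, by omega, by rw [hq2 p hp, h1], by rw [hq2 p hp, h2], h3⟩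
  · intro c hc u hu hcu ho
    by_cases hcu' : c = i ∧ u = E i (q h)
    · obtain ⟨rfl, rfl⟩ := hcu'
      exact ⟨tail, by omega, by rw [hq', hown]⟩
    · rw [update₂_of_ne _ _ hcu'] at hcu
      obtain ⟨p, hp, h1⟩ := S.pushed c hc u hu hcu ho
      exact ⟨p, by omega, by rw [hq2 p hp, h1]⟩
  · intro h0 c hc u hu hcu
    by_cases hcu' : c = i ∧ u = E i (q h)
    · obtain ⟨rfl, rfl⟩ := hcu'
      omega
    · rw [update₂_of_ne _ _ hcu'] at hcu
      exact S.owned h0 c hc u hu hcu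
  · intro h0
    obtain ⟨c, hc, h1, h2, h3, h4⟩ := S.found h0
    exact ⟨c, hc, h1, h2, h3, by rwa [hne _ _ h4]⟩
  · intro p hp c hc h' hne'
    have hp' : p < tail := by omega
    rw [hq2 p hp'] at hne' ⊢
    by_cases hpc : p = h ∧ c = i
    · obtain ⟨rfl, rfl⟩ := hpc
      simp
    · have := S.examined p hp' c hc (by omega) hne'
      rwa [hne _ _ this]

/-- If the search ends without a free slot, then the vertices in its queue have too few slots. -/
theorem not_hasTransversal (hE : ∀ c < k, ∀ x < n, E c x ≤ n)
    (hM : PartialAssignment n k E own col 0 0) (hρ : col ρ = 0)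
    (S : Search n k E own col ρ q par tail 0 fu h i) (hh : tail ≤ h) : ¬ HasTransversal n k E := by
  rintro ⟨f, hf, hinj⟩
  -- Every slot offered to a queued vertex has been reached and is owned by a queued vertex, which
  -- is not the root because the root owns nothing. A transversal would thus inject the `tail` queue
  -- positions into the `tail - 1` nonzero ones.
  have key : ∀ p < tail, ∃ p' < tail, p' ≠ 0 ∧
      own (f (q p)) (E (f (q p)) (q p)) = q p' + 1 := by
    intro p hp
    have hx := S.lt p hp
    obtain ⟨h1, h2⟩ := hf _ hx
    have h3 := S.examined p hp _ h1 (Or.inl (by omega)) h2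
    obtain ⟨p', hp', h4⟩ := S.pushed _ h1 _ (hE _ h1 _ hx) h3
      (S.owned rfl _ h1 _ (hE _ h1 _ hx) h3)
    refine ⟨p', hp', ?_, h4⟩
    rintro rfl
    have := (hM.owner _ h1 _ (hE _ h1 _ hx) (by omega) _ h4).2.1
    rw [S.root] at this
    omega
  choose! g hg using key
  have hcard := Finset.card_le_card_of_injOn (s := Finset.range tail)
    (t := (Finset.range tail).erase 0) g
    (fun p hp => by
      have := hg p (by simpa using hp)
      simpa using ⟨this.1, this.2.1⟩)
    (fun p hp p' hp' e => by
      have hp1 : p < tail := by simpa using hp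
      have hp2 : p' < tail := by simpa using hp'
      have h1 := hg p hp1
      have h2 := hg p' hp2
      rw [e] at h1
      have hx := S.lt p hp1
      have hy := S.lt p' hp2
      have h3 := hM.owner _ (hf _ hx).1 _ (hE _ (hf _ hx).1 _ hx) (by omega) _ h1.2.2
      have h4 := hM.owner _ (hf _ hy).1 _ (hE _ (hf _ hy).1 _ hy) (by omega) _ h2.2.2
      have h5 : f (q p) = f (q p') := by omega
      refine S.inj p hp1 p' hp2 (hinj _ hx _ hy h5 ?_)
      rw [← h3.2.2, ← h4.2.2, h5])
  have hp := S.tail_pos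
  rw [Finset.card_erase_of_mem (by simpa using hp)] at hcard
  simp only [Finset.card_range] at hcard
  omega

end Search

/-- The state of the augmentation along a path that ends in the slot `(cc - 1, fu)`: the vertex that
gets this slot is `q p` for some `p < m`. The coloring before the augmentation is `col₀`. -/
structure Augmentation (n k : ℕ) (E own : ℕ → ℕ → ℕ) (col₀ col : ℕ → ℕ) (ρ : ℕ) (q : ℕ → ℕ)
    (par : ℕ → ℕ → ℕ) (tail cc fu m : ℕ) : Prop where
  assignment : PartialAssignment n k E own col cc fu
  pending : cc ≠ 0 → ∃ c < k, cc = c + 1 ∧ fu ≤ n ∧ ∃ p < tail, p < m ∧ par c fu = q p + 1 ∧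
    E c (q p) = fu ∧ fu ≠ 0 ∧ ∀ p' ≤ p, col (q p') = col₀ (q p')
  mono : ∀ x, col₀ x ≠ 0 → col x ≠ 0
  root : cc = 0 → col ρ ≠ 0
  frame : ∀ x ≠ ρ, col₀ x = 0 → col x = 0

/-! ### Flipping an augmenting path. -/

namespace Augmentation

variable {n k : ℕ} {E own : ℕ → ℕ → ℕ} {col₀ col : ℕ → ℕ} {ρ : ℕ} {q : ℕ → ℕ}
    {par : ℕ → ℕ → ℕ} {tail cc fu m : ℕ}

theorem start {own₀ : ℕ → ℕ → ℕ}
    (hM : PartialAssignment n k E own₀ col₀ 0 0) {h i : ℕ}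
    (S : Search n k E own₀ col₀ ρ q par tail cc fu h i) (hcc : cc ≠ 0) :
    Augmentation n k E own₀ col₀ col₀ ρ q par tail cc fu tail := by
  obtain ⟨c, hc, rfl, h1, h2, h3⟩ := S.found hcc
  obtain ⟨p, hp, h4, h5, h6⟩ := S.parent c hc fu h1 h3
  refine ⟨⟨hM.color, fun c hc u hu _ => hM.owner c hc u hu (by omega), ?_⟩, ?_, fun _ h => h,
    fun h => absurd h hcc, fun _ _ h => h⟩
  · intro c' hc' x hx hxc hE
    obtain rfl : c = c' := by omega
    have := (hM.color x hx _ hxc).2.2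
    rw [hE] at this
    omega
  · intro _
    exact ⟨c, hc, rfl, h1, p, hp, hp, h4, h5, h6, fun _ _ => rfl⟩

/-- The parent x of the pending slot takes it over, and the old slot of x becomes pending. The
parent of that slot stands earlier in the queue, so the process ends, and it can end only at the
uncolored root. -/
theorem step (hE : ∀ c < k, ∀ x < n, E c x ≤ n) {own₀ : ℕ → ℕ → ℕ}
    (hM : PartialAssignment n k E own₀ col₀ 0 0) (hρ : col₀ ρ = 0) {cc₀ fu₀ h i : ℕ}
    (S : Search n k E own₀ col₀ ρ q par tail cc₀ fu₀ h i)
    (A : Augmentation n k E own col₀ col ρ q par tail cc fu m) (hcc : cc ≠ 0) {x : ℕ}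
    (hx : par (cc - 1) fu = x + 1) {col' : ℕ → ℕ} (hcx : col' x = cc)
    (hcol' : ∀ y ≠ x, col' y = col y) :
    ∃ m', m = m' + 1 ∧ Augmentation n k E (update₂ own (cc - 1) fu (x + 1)) col₀ col' ρ q par tail
      (col x) (E (col x - 1) x) m' := by
  obtain ⟨c, hc, rfl, hfu, p, hp, hpm, h1, h2, h3, h4⟩ := A.pending hcc
  simp only [Nat.add_sub_cancel] at hx ⊢
  obtain rfl : x = q p := by omega
  have hxn := S.lt p hp
  have M := A.assignment
  -- The next vertex has a position p' < p, and p < m, so m - 1 still bounds it strictly.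
  refine ⟨m - 1, by omega, ⟨?_, ?_, ?_⟩, ?_, ?_, ?_, ?_⟩
  · intro y hy c' hyc
    by_cases hyx : y = q p
    · subst hyx
      obtain rfl : c = c' := by omega
      refine ⟨hc, by omega, by rw [h2]; simp⟩
    · rw [hcol' y hyx] at hyc
      obtain ⟨h5, h6, h7⟩ := M.color y hy c' hyc
      refine ⟨h5, h6, ?_⟩
      rw [update₂_of_ne, h7]
      rintro ⟨rfl, h8⟩
      exact M.free _ rfl y hy hyc h8
  · intro c' hc' u hu hne y hy
    by_cases hcu : c' = c ∧ u = fu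
    · obtain ⟨rfl, rfl⟩ := hcu
      simp only [update₂_self] at hy
      obtain rfl : y = q p := by omega
      exact ⟨hxn, hcx, h2⟩
    · rw [update₂_of_ne _ _ hcu] at hy
      obtain ⟨h5, h6, h7⟩ := M.owner c' hc' u hu (by omega) y hy
      have hyx : y ≠ q p := by
        rintro rfl
        apply hne
        rw [h6]
        exact ⟨rfl, h7.symm⟩
      exact ⟨h5, by rw [hcol' y hyx, h6], h7⟩
  · intro c' hc' y hy hyc hEy
    rw [hc', Nat.add_sub_cancel] at hEy
    obtain ⟨h5, h6, h7⟩ := M.color _ hxn c' hc'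
    by_cases hyx : y = q p
    · subst hyx
      obtain rfl : c = c' := by omega
      exact M.free _ rfl _ hxn hc' h2
    · rw [hcol' y hyx] at hyc
      have h8 := (M.color y hy c' hyc).2.2
      rw [hEy] at h8
      omega
  · intro hpc
    -- The root was uncolored and has not been touched yet, so a vertex that has an old slot to pass
    -- on is not the root.
    have hp0 : 0 < p := by
      rcases Nat.eq_zero_or_pos p with rfl | h0
      · rw [h4 0 le_rfl, S.root] at hpc
        exact absurd hρ hpc
      · exact h0
    obtain ⟨c', p', h5, h6, h7⟩ := S.reached p hp hp0
    have h8 := (hM.color _ hxn c' h5)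
    have h9 : col (q p) = c' + 1 := by rw [h4 p le_rfl, h5]
    obtain ⟨p'', hp'', h10, h11, -⟩ := S.parent c' h8.1 _ (hE _ h8.1 _ hxn) (by omega)
    obtain rfl : p' = p'' := S.inj _ (by omega) _ hp'' (by omega)
    rw [h9, Nat.add_sub_cancel]
    refine ⟨c', h8.1, rfl, hE _ h8.1 _ hxn, p', hp'', by omega, h7, h11, h8.2.1, ?_⟩
    -- Only `q p` was recolored, and the positions up to p' lie before p; as the queue has no
    -- repetitions, they keep their original colors.
    intro r hr
    rw [hcol', h4 r (by omega)]
    intro e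
    have := S.inj _ (by omega) _ hp e
    omega
  · intro y hy
    by_cases hyx : y = q p
    · subst hyx
      omega
    · rw [hcol' y hyx]
      exact A.mono y hy
  · intro hpc
    -- All queued vertices other than the root had colors at the start, and that of `q p` is
    -- unchanged, so nothing is left pending only when the root is reached.
    have hp0 : p = 0 := by
      by_contra h0
      obtain ⟨c', p', h5, -⟩ := S.reached p hp (by omega)
      rw [h4 p le_rfl] at hpc
      omega
    subst hp0
    rw [← S.root]
    omega
  · intro y hyρ hy
    have hyx : y ≠ q p := by
      rintro rfl
      rcases Nat.eq_zero_or_pos p with rfl | h0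
      · exact hyρ S.root
      · obtain ⟨c', p', h5, -⟩ := S.reached p hp h0
        omega
    rw [hcol' y hyx]
    exact A.frame y hyρ hy

end Augmentation

end Transversal

/-! ## The program

The variables are used as follows: `0` holds `n`, `1` holds `0`, `2` holds `1`, `3` holds `k`, `4`
holds `n + 1`, `5` is a color, `6` is a vertex (the root of the search), `7` is a vertex or a slot
number, `10` and `11` delimit the queue, `12` and `13` describe the slot at the end of the augmenting
path, `14` is the vertex being processed, `17` is set when some search fails; `8`, `9`, `15`, `16`
are auxiliary. The kinds of arrays are: `0` offers, `1` owners of slots, `2` parents of slots in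
the search, `3` colors of vertices (shifted by one), `4` the queue. -/

namespace RAM

open RAM.Expr Transversal

/-- The constants are in place. -/
structure Ready (n k : ℕ) (σ : View) : Prop where
  n_eq : σ.var 0 = n
  zero_eq : σ.var 1 = 0
  one_eq : σ.var 2 = 1
  k_eq : σ.var 3 = k
  succ_eq : σ.var 4 = n + 1

/-! ### Computing the offers -/

open Classical in
/-- The successor of the largest number less than `m` with the property `P`, or `0`. -/
noncomputable def lastSucc (P : ℕ → Prop) : ℕ → ℕ
  | 0 => 0
  | m + 1 => if P m then m + 1 else lastSucc P m

open Classical in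
/-- The input holds the relations `lst` (color `c` is in the list of `v`) and `adj`. -/
structure Encodes (n k : ℕ) (I : ℕ → ℕ) (lst adj : ℕ → ℕ → Prop) : Prop where
  list : ∀ v < n, ∀ c < k, I (n * n + (v * k + c)) = if lst c v then 1 else 0
  adj : ∀ v < n, ∀ u < n, I (v * n + u) = if adj v u then 1 else 0

/-- The vertices `u` that belong to the clique of `v` in color `c`. -/
def Candidate (lst adj : ℕ → ℕ → Prop) (c v u : ℕ) : Prop :=
  lst c v ∧ lst c u ∧ (adj v u ∨ v = u)

theorem mul_add_lt {v n k c : ℕ} (hv : v < n) (hc : c < k) : v * k + c < n * k := by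
  have := Nat.mul_le_mul_right k (Nat.succ_le_of_lt hv)
  rw [Nat.succ_mul] at this
  omega

def inList (v : ℕ) : Expr :=
  .input (.add (.mul (.var 0) (.var 0)) (.add (.mul (.var v) (.var 3)) (.var 5)))

/-- The product of two 0/1 entries is the conjunction of the two list memberships. The candidates
come in increasing order and each overwrites the previous one, so the largest survives. -/
def offerStep (k : ℕ) : Prog :=
  .seq (setVar k 8 (.mul (inList 6) (inList 7))) <|
  .seq (setVar k 9 (.input (.add (.mul (.var 6) (.var 0)) (.var 7)))) <|
  .branch (.eq 8 1) .skip <|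
  .branch (.eq 9 2) (setArr k 0 (.var 5) (.var 6) (.add (.var 7) (.const 1))) <|
  .branch (.eq 6 7) (setArr k 0 (.var 5) (.var 6) (.add (.var 7) (.const 1))) .skip

def offers (k : ℕ) : Prog :=
  forLoop k 5 3 <| forLoop k 6 0 <|
    .seq (setArr k 0 (.var 5) (.var 6) (.const 0)) (forLoop k 7 0 (offerStep k))

def offersCost (n k : ℕ) : ℕ :=
  forCost k 5 k <| forCost k 6 n <|
    (setArr k 0 (.var 5) (.var 6) (.const 0)).cost + forCost k 7 n (offerStep k).cost

/-- The invariant of the computation: the offers to the vertices before `v` for color `c`, and all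
offers of the colors before `c` are known, and the other arrays are not in use. -/
structure OfferInv (n k : ℕ) (lst adj : ℕ → ℕ → Prop) (c v : ℕ) (σ : View) : Prop where
  ready : Ready n k σ
  arr : ∀ j ≠ 0, σ.arr j = fun _ _ => 0
  offer : ∀ c' < k, ∀ v' < n, (c' < c ∨ (c' = c ∧ v' < v)) →
    σ.arr 0 c' v' = lastSucc (Candidate lst adj c' v') n
  fail : σ.var 17 = 0

section

variable {n k W : ℕ} {I : ℕ → ℕ} {lst adj : ℕ → ℕ → Prop}

theorem Ready.setVar {σ : View} (h : Ready n k σ) {d x : ℕ} (hd : 4 < d) :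
    Ready n k (σ.setVar d x) := by
  constructor <;> rw [View.setVar_var, if_neg (by omega)]
  exacts [h.n_eq, h.zero_eq, h.one_eq, h.k_eq, h.succ_eq]

theorem Ready.setArr {σ : View} (h : Ready n k σ) {j c a x : ℕ} : Ready n k (σ.setArr j c a x) :=
  ⟨h.n_eq, h.zero_eq, h.one_eq, h.k_eq, h.succ_eq⟩

theorem OfferInv.setVar {c v : ℕ} {σ : View} (h : OfferInv n k lst adj c v σ) {d x : ℕ}
    (hd : 4 < d) (hd' : d ≠ 17) : OfferInv n k lst adj c v (σ.setVar d x) :=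
  ⟨h.ready.setVar hd, h.arr, h.offer, by simpa [hd'.symm] using h.fail⟩

/-- The invariant speaks only of cells before (c, v), so the current cell may be overwritten freely.
-/
theorem OfferInv.setArr {c v a : ℕ} {σ : View} (h : OfferInv n k lst adj c v σ) :
    OfferInv n k lst adj c v (σ.setArr 0 c v a) := by
  refine ⟨h.ready.setArr, fun j hj => by simpa [hj] using h.arr j hj, fun c' hc' v' hv' hlt => ?_,
    h.fail⟩
  rw [← h.offer c' hc' v' hv' hlt]
  simp only [View.setArr_arr, if_true]
  exact update₂_of_ne _ _ (by omega)

theorem safe_inList (hW : LargeWord n k W) (hI : Encodes n k I lst adj) {σ : View}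
    (hσ : Ready n k σ) {i : ℕ} (hi : i < 20) (hv : σ.var i < n) (hc : σ.var 5 < k) :
    (inList i).Safe n k W I σ := by
  have h1 := mul_add_lt hv hc
  have h2 : I (n * n + (σ.var i * k + σ.var 5)) ≤ 1 := by
    rw [hI.list _ hv _ hc]; split_ifs <;> simp
  have h3 : n * n + n * k ≤ W := hW.le_of_le (by omega)
  have hn : n ≤ n * n := Nat.le_mul_self n
  have hk : k ≤ n * k := Nat.le_mul_of_pos_left k (by omega)
  simp only [inList, Safe, eval, hσ.n_eq, hσ.k_eq, base]
  refine ⟨⟨⟨?_, ?_, ?_⟩, ⟨⟨?_, ?_, ?_⟩, ?_, ?_⟩, ?_⟩, ?_, ?_⟩ <;> omega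

open Classical in
theorem eval_inList (hI : Encodes n k I lst adj) {σ : View} (hσ : Ready n k σ) {i : ℕ} (hv : σ.var i < n) (hc : σ.var 5 < k) :
    (inList i).eval I σ = if lst (σ.var 5) (σ.var i) then 1 else 0 := by
  simp only [inList, eval, hσ.n_eq, hσ.k_eq]
  rw [hI.list _ hv _ hc]

theorem leads_offerStep (hW : LargeWord n k W) (hI : Encodes n k I lst adj) {c v u : ℕ}
    (hc : c < k) (hv : v < n) (hu : u < n) {σ : View} (hσ : OfferInv n k lst adj c v σ)
    (h5 : σ.var 5 = c) (h6 : σ.var 6 = v) (h7 : σ.var 7 = u)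
    (h0 : σ.arr 0 c v = lastSucc (Candidate lst adj c v) u) :
    Leads n k W I (offerStep k) (fun σ' => σ'.var 5 = c ∧ σ'.var 6 = v ∧ σ'.var 7 = u ∧
      OfferInv n k lst adj c v σ' ∧ σ'.arr 0 c v = lastSucc (Candidate lst adj c v) (u + 1)) σ := by
  classical
  have hW1 : 1 ≤ W := hW.le_of_le (by omega)
  have hWn : n * n + n * k ≤ W := hW.le_of_le (by omega)
  have hn : n ≤ n * n := Nat.le_mul_self n
  have hk : k ≤ n * k := Nat.le_mul_of_pos_left k (by omega)
  have hR := hσ.ready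
  refine Leads.seq (Leads.setVar hW (by norm_num) ⟨safe_inList hW hI hR (by norm_num) (by omega)
    (by omega), safe_inList hW hI hR (by norm_num) (by omega) (by omega), ?_⟩ ?_)
  · rw [eval_inList hI hR (by omega) (by omega), eval_inList hI hR (by omega) (by omega)]
    split_ifs <;> omega
  rw [eval, eval_inList hI hR (by omega) (by omega), eval_inList hI hR (by omega) (by omega),
    h5, h6, h7]
  have hadj := hI.adj v hv u hu
  have hvu := mul_add_lt hv hu
  refine Leads.seq (Leads.setVar hW (by norm_num) ?_ ?_)
  · simp only [Safe, eval, View.setVar_var, base, h6, h7, hR.n_eq]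
    norm_num
    have hle : I (v * n + u) ≤ 1 := by rw [hadj]; split_ifs <;> omega
    omega
  have hval : eval I (σ.setVar 8 ((if lst c v then 1 else 0) * if lst c u then 1 else 0))
      (.input (.add (.mul (.var 6) (.var 0)) (.var 7))) = if adj v u then 1 else 0 := by
    simpa [h6, h7, hR.n_eq] using hadj
  rw [hval]
  set x := (if lst c v then 1 else 0) * if lst c u then 1 else 0 with hx
  set y := if adj v u then 1 else 0 with hy
  have hτ : OfferInv n k lst adj c v ((σ.setVar 8 x).setVar 9 y) :=
    (hσ.setVar (by norm_num) (by norm_num)).setVar (by norm_num) (by norm_num)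
  have hlast : lastSucc (Candidate lst adj c v) (u + 1) =
      if Candidate lst adj c v u then u + 1 else lastSucc (Candidate lst adj c v) u := rfl
  have hput : Candidate lst adj c v u → Leads n k W I
      (RAM.setArr k 0 (.var 5) (.var 6) (.add (.var 7) (.const 1)))
      (fun σ' => σ'.var 5 = c ∧ σ'.var 6 = v ∧ σ'.var 7 = u ∧
        OfferInv n k lst adj c v σ' ∧ σ'.arr 0 c v = lastSucc (Candidate lst adj c v) (u + 1))
      ((σ.setVar 8 x).setVar 9 y) := by
    intro hcand
    refine Leads.setArr hW (by norm_num) ?_ ?_ ?_ ?_ ?_ ?_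
    · simp [h5]; omega
    · simp [h6]; omega
    · simp [h7]; omega
    · simp [h5, hc]
    · simp [h6]; omega
    · simp only [eval, View.setVar_var]
      norm_num [h5, h6, h7]
      exact ⟨hτ.setArr, by rw [hlast, if_pos hcand]⟩
  have hkeep : ¬ Candidate lst adj c v u → ((σ.setVar 8 x).setVar 9 y).var 5 = c ∧
      ((σ.setVar 8 x).setVar 9 y).var 6 = v ∧ ((σ.setVar 8 x).setVar 9 y).var 7 = u ∧
      OfferInv n k lst adj c v ((σ.setVar 8 x).setVar 9 y) ∧
      ((σ.setVar 8 x).setVar 9 y).arr 0 c v = lastSucc (Candidate lst adj c v) (u + 1) := by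
    intro hcand
    refine ⟨by simpa using h5, by simpa using h6, by simpa using h7, hτ, ?_⟩
    rw [hlast, if_neg hcand]
    exact h0
  refine Leads.branch (by norm_num) (by norm_num) (fun h => Leads.skip (hkeep ?_)) fun h => ?_
  · simp [hR.zero_eq, hx] at h
    exact fun hcand => h hcand.2.1 hcand.1
  have hlst : lst c v ∧ lst c u := by
    simpa [hR.zero_eq, hx, and_comm] using h
  refine Leads.branch (by norm_num) (by norm_num) (fun h => hput ?_) fun h => ?_
  · simp [hR.one_eq, hy] at h
    exact ⟨hlst.1, hlst.2, Or.inl h⟩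
  have hadj' : ¬ adj v u := by
    simpa [hR.one_eq, hy] using h
  refine Leads.branch (by norm_num) (by norm_num) (fun h => hput ?_)
    fun h => Leads.skip (hkeep ?_)
  · simp [h6, h7] at h
    exact ⟨hlst.1, hlst.2, Or.inr h⟩
  · simp [h6, h7] at h
    exact fun hcand => hcand.2.2.elim hadj' h

theorem leads_offers (hW : LargeWord n k W) (hI : Encodes n k I lst adj) {σ : View}
    (hσ : OfferInv n k lst adj 0 0 σ) :
    LeadsIn n k W I (offersCost n k) (offers k) (OfferInv n k lst adj k 0) σ := by
  have hWk : k ≤ W := hW.le_of_le (by omega)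
  have hWn : n ≤ W := hW.le_of_le (by have := Nat.le_mul_self n; omega)
  refine LeadsIn.forLoop hW (by norm_num) (by norm_num) hWk
    (fun c σ => OfferInv n k lst adj c 0 σ) (fun _ _ h => h.ready.k_eq) ?_ (fun _ h => h)
    (hσ.setVar (by norm_num) (by norm_num))
  intro c σ hc hσ h5
  refine LeadsIn.forLoop hW (by norm_num) (by norm_num) hWn
    (fun v σ => OfferInv n k lst adj c v σ ∧ σ.var 5 = c) (fun _ _ h => h.1.ready.n_eq) ?_ ?_
    ⟨hσ.setVar (by norm_num) (by norm_num), by simpa using h5⟩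
  · rintro v σ hv ⟨hσ, h5⟩ h6
    refine LeadsIn.seq (Leads.leadsIn (loopFree_setArr _ _ _ _ _)
      (Leads.setArr hW (by norm_num) ?_ ?_ ?_ ?_ ?_ ?_))
    · simp [h5]; omega
    · simp [h6]; omega
    · simp
    · simp [h5, hc]
    · simp [h6]; omega
    simp only [eval, h5, h6]
    refine LeadsIn.forLoop hW (by norm_num) (by norm_num) hWn
      (fun u σ => OfferInv n k lst adj c v σ ∧ σ.var 5 = c ∧ σ.var 6 = v ∧
        σ.arr 0 c v = lastSucc (Candidate lst adj c v) u) (fun _ _ h => h.1.ready.n_eq) ?_ ?_ ?_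
    · rintro u σ hu ⟨hσ, h5, h6, h0⟩ h7
      refine (Leads.leadsIn (by simp [offerStep])
        (leads_offerStep hW hI hc hv hu hσ h5 h6 h7 h0)).mono le_rfl ?_
      rintro τ ⟨h5, h6, h7, hτ, h0⟩
      exact ⟨h7, hτ.setVar (by norm_num) (by norm_num), by simpa using h5, by simpa using h6, h0⟩
    · rintro σ ⟨hσ, h5, h6, h0⟩
      refine ⟨h6, ?_, by simpa using h5⟩
      refine OfferInv.setVar ⟨hσ.ready, hσ.arr, fun c' hc' v' hv' hlt => ?_, hσ.fail⟩
        (by norm_num) (by norm_num)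
      by_cases hcv : c' = c ∧ v' = v
      · obtain ⟨rfl, rfl⟩ := hcv
        exact h0
      · exact hσ.offer c' hc' v' hv' (by omega)
    · exact ⟨hσ.setArr.setVar (by norm_num) (by norm_num), by simpa using h5, by simpa using h6,
        by simp [lastSucc]⟩
  · rintro σ ⟨hσ, h5⟩
    refine ⟨h5, OfferInv.setVar ⟨hσ.ready, hσ.arr, fun c' hc' v' hv' hlt => ?_, hσ.fail⟩
      (by norm_num) (by norm_num)⟩
    exact hσ.offer c' hc' v' hv' (by omega)

end

/-! ### The search -/

/-- Slot numbers are successors of vertices and can equal n, hence the inner bound n + 1 held in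
variable 4. -/
def clearParents (k : ℕ) : Prog :=
  forLoop k 5 3 <| forLoop k 7 4 (setArr k 2 (.var 5) (.var 7) (.const 0))

def clearParentsCost (n k : ℕ) : ℕ :=
  forCost k 5 k <| forCost k 7 (n + 1) (setArr k 2 (.var 5) (.var 7) (.const 0)).cost

def examine (k : ℕ) : Prog :=
  .seq (setVar k 7 (.get 0 (.var 5) (.var 14))) <|
  .branch (.eq 7 1) .skip <|
  .seq (setVar k 15 (.get 2 (.var 5) (.var 7))) <|
  .branch (.eq 15 1)
    (.seq (setArr k 2 (.var 5) (.var 7) (.add (.var 14) (.const 1))) <|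
     .seq (setVar k 15 (.get 1 (.var 5) (.var 7))) <|
     .branch (.eq 15 1)
      (.seq (setVar k 12 (.add (.var 5) (.const 1))) (setVar k 13 (.var 7)))
      (.seq (setArr k 4 (.const 0) (.var 11) (.sub (.var 15) (.const 1)))
        (setVar k 11 (.add (.var 11) (.const 1)))))
    .skip

def dequeue (k : ℕ) : Prog :=
  .seq (setVar k 14 (.get 4 (.const 0) (.var 10))) (setVar k 10 (.add (.var 10) (.const 1)))

/-- The search runs until the queue is exhausted even if a free slot turns up; a free slot found
later replaces the earlier one, and either would do. -/
def search (k : ℕ) : Prog :=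
  .loop (.lt 10 11) (.seq (dequeue k) (forLoop k 5 3 (examine k)))

def searchCost (n k : ℕ) : ℕ :=
  n * (((dequeue k).cost + forCost k 5 k (examine k).cost) + 1) + 1

/-- The data that do not change during a search. -/
structure Fixed (n k : ℕ) (E own : ℕ → ℕ → ℕ) (col : ℕ → ℕ) (ρ fl : ℕ) (σ : View) : Prop where
  ready : Ready n k σ
  offer : σ.arr 0 = E
  own : σ.arr 1 = own
  col : σ.arr 3 0 = col
  root : σ.var 6 = ρ
  fail : σ.var 17 = fl

/-- The state of the search in memory. -/
def SearchInv (n k : ℕ) (E own : ℕ → ℕ → ℕ) (col : ℕ → ℕ) (ρ h i : ℕ) (σ : View) : Prop :=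
  Search n k E own col ρ (σ.arr 4 0) (σ.arr 2) (σ.var 11) (σ.var 12) (σ.var 13) h i

section

variable {n k W : ℕ} {I : ℕ → ℕ} {E own : ℕ → ℕ → ℕ} {col : ℕ → ℕ} {ρ fl : ℕ} {σ : View}

theorem Fixed.setVar (h : Fixed n k E own col ρ fl σ) {d x : ℕ} (hd : 4 < d) (hd6 : d ≠ 6)
    (hd17 : d ≠ 17) : Fixed n k E own col ρ fl (σ.setVar d x) :=
  ⟨h.ready.setVar hd, h.offer, h.own, h.col, by simpa [hd6.symm] using h.root,
    by simpa [hd17.symm] using h.fail⟩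

theorem Fixed.setArr (h : Fixed n k E own col ρ fl σ) {j c a x : ℕ} (hj : j = 2 ∨ j = 4) :
    Fixed n k E own col ρ fl (σ.setArr j c a x) := by
  refine ⟨h.ready.setArr, ?_, ?_, ?_, h.root, h.fail⟩ <;> rw [View.setArr_arr, if_neg (by omega)]
  exacts [h.offer, h.own, h.col]

theorem SearchInv.setVar {h i : ℕ} (hS : SearchInv n k E own col ρ h i σ) {d x : ℕ} (h11 : d ≠ 11)
    (h12 : d ≠ 12) (h13 : d ≠ 13) : SearchInv n k E own col ρ h i (σ.setVar d x) := by
  unfold SearchInv at *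
  simpa [h11.symm, h12.symm, h13.symm] using hS

theorem leads_clearParents (hW : LargeWord n k W) (hF : Fixed n k E own col ρ fl σ) :
    LeadsIn n k W I (clearParentsCost n k) (clearParents k) (fun σ' =>
      Fixed n k E own col ρ fl σ' ∧ ∀ c < k, ∀ u ≤ n, σ'.arr 2 c u = 0) σ := by
  have hWk : k ≤ W := hW.le_of_le (by omega)
  have hWn : n + 1 ≤ W := hW.le_of_le (by have := Nat.le_mul_self n; omega)
  refine LeadsIn.forLoop hW (by norm_num) (by norm_num) hWk
    (fun c σ => Fixed n k E own col ρ fl σ ∧ ∀ c' < c, ∀ u ≤ n, σ.arr 2 c' u = 0)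
    (fun _ _ h => h.1.ready.k_eq) ?_ (fun _ h => h)
    ⟨hF.setVar (by norm_num) (by norm_num) (by norm_num), fun c' hc' => by omega⟩
  rintro c σ hc ⟨hF, h2⟩ h5
  refine LeadsIn.forLoop hW (by norm_num) (by norm_num) hWn
    (fun u σ => Fixed n k E own col ρ fl σ ∧ σ.var 5 = c ∧
      ∀ c' u', u' ≤ n → (c' < c ∨ (c' = c ∧ u' < u)) → σ.arr 2 c' u' = 0)
    (fun _ _ h => h.1.ready.succ_eq) ?_ ?_
    ⟨hF.setVar (by norm_num) (by norm_num) (by norm_num), by simpa using h5,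
      fun c' u' hu' hlt => h2 c' (by omega) u' hu'⟩
  · rintro u σ hu ⟨hF, h5, h2⟩ h7
    refine Leads.leadsIn (loopFree_setArr _ _ _ _ _)
      (Leads.setArr hW (by norm_num) ?_ ?_ ?_ ?_ ?_ ?_)
    · simp [h5]; omega
    · simp [h7]; omega
    · simp
    · simp [h5, hc]
    · simp [h7]; omega
    refine ⟨h7, (hF.setArr (by norm_num)).setVar (by norm_num) (by norm_num) (by norm_num),
      by simpa using h5, ?_⟩
    intro c' u' hu' hlt
    simp only [View.setVar_arr, View.setArr_arr, if_true, eval, h5, h7]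
    by_cases hcu : c' = c ∧ u' = u
    · rw [hcu.1, hcu.2, update₂_self]
    · rw [update₂_of_ne _ _ hcu]
      exact h2 c' u' hu' (by omega)
  · rintro σ ⟨hF, h5, h2⟩
    exact ⟨h5, hF.setVar (by norm_num) (by norm_num) (by norm_num),
      fun c' hc' u hu => h2 c' u hu (by omega)⟩

theorem leads_examine (hW : LargeWord n k W) (hE : ∀ c < k, ∀ x < n, E c x ≤ n)
    (hM : PartialAssignment n k E own col 0 0) (hρ : col ρ = 0) (hF : Fixed n k E own col ρ fl σ)
    {h i : ℕ} (hi : i < k) (hS : SearchInv n k E own col ρ h i σ) (hh : h < σ.var 11)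
    (h14 : σ.var 14 = σ.arr 4 0 h) (h5 : σ.var 5 = i) :
    Leads n k W I (examine k) (fun σ' => Fixed n k E own col ρ fl σ' ∧
      SearchInv n k E own col ρ h (i + 1) σ' ∧ h < σ'.var 11 ∧ σ'.var 14 = σ'.arr 4 0 h ∧
      σ'.var 5 = i ∧ σ'.var 10 = σ.var 10) σ := by
  have hWn : n + k + 1 ≤ W := hW.le_of_le (by have := Nat.le_mul_self n; omega)
  have S : Search n k E own col ρ (σ.arr 4 0) (σ.arr 2) (σ.var 11) (σ.var 12) (σ.var 13) h i := hS
  have hxn := S.lt h hh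
  have hEu := hE i hi _ hxn
  have htail := S.tail_le
  have hR := hF.ready
  set x := σ.arr 4 0 h with hx
  set u := E i x with hu
  have hpar : σ.arr 2 i u ≤ n := S.par_le hi hEu
  have hown : own i u ≤ n := hM.own_le hi hEu
  refine Leads.seq (Leads.setVar hW (by norm_num) ?_ ?_)
  · simp only [Safe, eval, hF.offer, h5, h14, ← hu]
    omega
  simp only [eval, hF.offer, h5, h14, ← hu]
  have hF₁ : Fixed n k E own col ρ fl (σ.setVar 7 u) :=
    hF.setVar (by norm_num) (by norm_num) (by norm_num)
  refine Leads.branch (by norm_num) (by norm_num) (fun h0 => Leads.skip ?_) fun h0 => ?_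
  · simp [hR.zero_eq] at h0
    refine ⟨hF₁, SearchInv.setVar (S.examine_old fun h => absurd h0 h) (by norm_num) (by norm_num)
      (by norm_num), ?_, ?_, ?_, ?_⟩ <;> simp [hh, h14, h5, hx]
  simp [hR.zero_eq] at h0
  refine Leads.seq (Leads.setVar hW (by norm_num) ?_ ?_)
  · simp [h5]
    omega
  simp only [eval, View.setVar_var, View.setVar_arr]
  norm_num [h5]
  have hF₂ : Fixed n k E own col ρ fl ((σ.setVar 7 u).setVar 15 (σ.arr 2 i u)) :=
    hF₁.setVar (by norm_num) (by norm_num) (by norm_num)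
  refine Leads.branch (by norm_num) (by norm_num) (fun h2 => ?_) fun h2 => Leads.skip ?_
  swap
  · simp [hR.zero_eq] at h2
    refine ⟨hF₂, SearchInv.setVar (SearchInv.setVar (S.examine_old fun _ => h2) (by norm_num)
      (by norm_num) (by norm_num)) (by norm_num) (by norm_num) (by norm_num), ?_, ?_, ?_, ?_⟩ <;>
      simp [hh, h14, h5, hx]
  simp [hR.zero_eq] at h2
  refine Leads.seq (Leads.setArr hW (by norm_num) ?_ ?_ ?_ ?_ ?_ ?_)
  · simp [h5]; omega
  · simp; omega
  · simp [h14]; omega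
  · simp [h5, hi]
  · simpa using hEu
  simp only [eval, View.setVar_var]
  norm_num [h5, h14]
  have hF₃ : Fixed n k E own col ρ fl
      (((σ.setVar 7 u).setVar 15 (σ.arr 2 i u)).setArr 2 i u (x + 1)) :=
    hF₂.setArr (by norm_num)
  refine Leads.seq (Leads.setVar hW (by norm_num) ?_ ?_)
  · simp [h5, hF.own]
    omega
  simp only [eval, View.setVar_var, View.setVar_arr, View.setArr_arr, View.setArr_var]
  norm_num [h5, hF.own]
  have hF₄ : Fixed n k E own col ρ fl
      ((((σ.setVar 7 u).setVar 15 (σ.arr 2 i u)).setArr 2 i u (x + 1)).setVar 15 (own i u)) :=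
    hF₃.setVar (by norm_num) (by norm_num) (by norm_num)
  refine Leads.branch (by norm_num) (by norm_num) (fun h1 => ?_) fun h1 => ?_
  · simp [hR.zero_eq] at h1
    refine Leads.seq (Leads.setVar hW (by norm_num) ?_ ?_)
    · simp [h5]
      omega
    refine Leads.setVar hW (by norm_num) ?_ ?_
    · simp
      omega
    refine ⟨(hF₄.setVar (by norm_num) (by norm_num) (by norm_num)).setVar (by norm_num)
      (by norm_num) (by norm_num), ?_, ?_, ?_, ?_, ?_⟩
    · have := S.examine_free hh hi hEu h0 h2 h1
      unfold SearchInv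
      simpa [h5] using this
    all_goals simp [hh, h14, h5, hx]
  · simp [hR.zero_eq] at h1
    obtain ⟨w, hw⟩ : ∃ w, own i u = w + 1 := ⟨own i u - 1, by omega⟩
    have hS' := S.examine_owned hM hρ hh hi hEu h0 h2 hw
      (q' := update₂ (σ.arr 4) 0 (σ.var 11) w 0) (by simp)
      (fun p hp => update₂_of_ne _ _ (by omega))
    have htail' := hS'.tail_le
    refine Leads.seq (Leads.setArr hW (by norm_num) ?_ ?_ ?_ ?_ ?_ ?_)
    · simp
    · simp; omega
    · simp; omega
    · simp; omega
    · simp; omega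
    refine Leads.setVar hW (by norm_num) ?_ ?_
    · simp
      omega
    refine ⟨(hF₄.setArr (by norm_num)).setVar (by norm_num) (by norm_num) (by norm_num),
      ?_, ?_, ?_, ?_, ?_⟩
    · unfold SearchInv
      simpa [hw] using hS'
    · simp; omega
    · simp [h14, hx]
      rw [update₂_of_ne]
      omega
    all_goals simp [h5]

/-- Each round dequeues one vertex, and at most n vertices are ever queued, so n minus the head of
the queue bounds the rounds left. -/
theorem leads_search (hW : LargeWord n k W) (hk : 0 < k) (hE : ∀ c < k, ∀ x < n, E c x ≤ n)
    (hM : PartialAssignment n k E own col 0 0) (hρ : col ρ = 0) (hF : Fixed n k E own col ρ fl σ)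
    (hS : SearchInv n k E own col ρ 0 0 σ) (h10 : σ.var 10 = 0) :
    LeadsIn n k W I (searchCost n k) (search k) (fun σ' => Fixed n k E own col ρ fl σ' ∧
      ∃ h, σ'.var 11 ≤ h ∧ SearchInv n k E own col ρ h 0 σ') σ := by
  have hWn : n + k + 1 ≤ W := hW.le_of_le (by have := Nat.le_mul_self n; omega)
  refine LeadsIn.loop (by norm_num) (by norm_num) (fun m σ => Fixed n k E own col ρ fl σ ∧
    SearchInv n k E own col ρ (σ.var 10) 0 σ ∧ σ.var 10 + m = n) ?_ ?_ n
    ⟨hF, by rwa [h10], by omega⟩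
  · rintro m σ ⟨hF, hS, hm⟩ hlt
    have htail := Search.tail_le hS
    have hxn := Search.lt hS _ hlt
    obtain ⟨m', rfl⟩ : ∃ m', m = m' + 1 := ⟨m - 1, by omega⟩
    refine ⟨m', rfl, LeadsIn.seq (Leads.leadsIn (by simp [dequeue]) (Leads.seq
      (Leads.setVar hW (by norm_num) ?_ (Leads.setVar hW (by norm_num) ?_ ?_))))⟩
    · simp
      omega
    · simp
      omega
    simp only [eval, View.setVar_var]
    norm_num
    set h := σ.var 10 with hh
    refine LeadsIn.forLoop hW (by norm_num) (by norm_num) (by omega)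
      (fun i σ => Fixed n k E own col ρ fl σ ∧ SearchInv n k E own col ρ h i σ ∧ h < σ.var 11 ∧
        σ.var 14 = σ.arr 4 0 h ∧ σ.var 10 = h + 1) (fun _ _ h => h.1.ready.k_eq) ?_ ?_ ?_
    · rintro i σ hi ⟨hF, hS, hlt, h14, h10⟩ h5
      refine (Leads.leadsIn (by simp [examine])
        (leads_examine hW hE hM hρ hF hi hS hlt h14 h5)).mono le_rfl ?_
      rintro τ ⟨hF, hS, hlt, h14, h5, h10'⟩
      refine ⟨h5, hF.setVar (by norm_num) (by norm_num) (by norm_num),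
        hS.setVar (by norm_num) (by norm_num) (by norm_num), by simpa using hlt, by simpa using h14,
        by simp [h10', h10]⟩
    · rintro σ ⟨hF, hS, hlt, h14, h10⟩
      refine ⟨hF, ?_, by omega⟩
      rw [h10]
      exact Search.next hS
    · refine ⟨Fixed.setVar (Fixed.setVar (hF.setVar ?_ ?_ ?_) ?_ ?_ ?_) ?_ ?_ ?_,
        SearchInv.setVar (SearchInv.setVar (hS.setVar ?_ ?_ ?_) ?_ ?_ ?_) ?_ ?_ ?_, ?_, ?_, ?_⟩
      all_goals simp [hlt]
  · rintro m σ ⟨hF, hS, hm⟩ hlt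
    exact ⟨hF, _, by omega, hS⟩

end

/-! ### Augmentation -/

def augmentStep (k : ℕ) : Prog :=
  .seq (setVar k 14 (.sub (.get 2 (.sub (.var 12) (.const 1)) (.var 13)) (.const 1))) <|
  .seq (setVar k 16 (.get 3 (.const 0) (.var 14))) <|
  .seq (setArr k 1 (.sub (.var 12) (.const 1)) (.var 13) (.add (.var 14) (.const 1))) <|
  .seq (setArr k 3 (.const 0) (.var 14) (.var 12)) <|
  -- Variable 16 keeps the color that was just overwritten. If it is 0, the truncated subtraction
  -- reads a meaningless offer of color 0, which is harmless since variable 12 becomes 0 and no slot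
  -- is pending.
  .seq (setVar k 13 (.get 0 (.sub (.var 16) (.const 1)) (.var 14))) (setVar k 12 (.var 16))

/-- Variable 1 is constantly 0, so the test asks whether a slot is pending. -/
def augment (k : ℕ) : Prog := .loop (.lt 1 12) (augmentStep k)

def augmentCost (n k : ℕ) : ℕ := n * ((augmentStep k).cost + 1) + 1

/-- The state of the augmentation in memory. -/
structure AugmentInv (n k : ℕ) (E : ℕ → ℕ → ℕ) (col₀ : ℕ → ℕ) (ρ fl : ℕ) (q : ℕ → ℕ)
    (par : ℕ → ℕ → ℕ) (tail m : ℕ) (σ : View) : Prop where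
  ready : Ready n k σ
  offer : σ.arr 0 = E
  parent : σ.arr 2 = par
  root : σ.var 6 = ρ
  fail : σ.var 17 = fl
  augmentation : Augmentation n k E (σ.arr 1) col₀ (σ.arr 3 0) ρ q par tail (σ.var 12) (σ.var 13) m

section

variable {n k W : ℕ} {I : ℕ → ℕ} {E own : ℕ → ℕ → ℕ} {col : ℕ → ℕ} {ρ fl : ℕ} {σ : View}

theorem leads_augmentStep (hW : LargeWord n k W) (hE : ∀ c < k, ∀ x < n, E c x ≤ n)
    (hM : PartialAssignment n k E own col 0 0) (hρ : col ρ = 0) {q : ℕ → ℕ} {par : ℕ → ℕ → ℕ}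
    {tail cc₀ fu₀ h i m : ℕ} (S : Search n k E own col ρ q par tail cc₀ fu₀ h i)
    (hA : AugmentInv n k E col ρ fl q par tail m σ) (hcc : σ.var 12 ≠ 0) :
    ∃ m', m = m' + 1 ∧ Leads n k W I (augmentStep k) (AugmentInv n k E col ρ fl q par tail m') σ := by
  have hWn : n + k + 1 ≤ W := hW.le_of_le (by have := Nat.le_mul_self n; omega)
  obtain ⟨hR, h0, h2, h6, h17, A⟩ := hA
  obtain ⟨c, hc, h12, hfu, p, hp, -, hpar, -⟩ := A.pending hcc
  have hxn := S.lt p hp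
  set x := q p with hx
  have hcol := A.assignment.col_le hxn
  have hEx := hE (σ.arr 3 0 x - 1) (by omega) x hxn
  obtain ⟨m', hm, A'⟩ := A.step hE hM hρ S hcc (x := x) (by rw [h12]; exact hpar)
    (col' := update₂ (σ.arr 3) 0 x (σ.var 12) 0) (by simp)
    (fun y hy => update₂_of_ne _ _ (by omega))
  refine ⟨m', hm, ?_⟩
  have hx14 : eval I σ (.sub (.get 2 (.sub (.var 12) (.const 1)) (.var 13)) (.const 1)) = x := by
    simp [h2, h12, hpar]
  refine Leads.seq (Leads.setVar hW (by norm_num) ?_ ?_)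
  · simp [h2, h12, hpar]
    omega
  rw [hx14]
  refine Leads.seq (Leads.setVar hW (by norm_num) ?_ ?_)
  · simp
    omega
  refine Leads.seq (Leads.setArr hW (by norm_num) ?_ ?_ ?_ ?_ ?_ ?_)
  · simp; omega
  · simp; omega
  · simp; omega
  · simp; omega
  · simpa using hfu
  refine Leads.seq (Leads.setArr hW (by norm_num) ?_ ?_ ?_ ?_ ?_ ?_)
  · simp
  · simp; omega
  · simp; omega
  · simp; omega
  · simp; omega
  refine Leads.seq (Leads.setVar hW (by norm_num) ?_ ?_)
  · simp [h0]
    omega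
  refine Leads.setVar hW (by norm_num) ?_ ?_
  · simp
    omega
  constructor
  · constructor <;> simp [hR.n_eq, hR.zero_eq, hR.one_eq, hR.k_eq, hR.succ_eq]
  · simpa using h0
  · simpa using h2
  · simpa using h6
  · simpa using h17
  · simpa [h0] using A'

/-- The queue position bound drops in every step and starts at the length of the queue, so at most n
steps occur. -/
theorem leads_augment (hW : LargeWord n k W) (hE : ∀ c < k, ∀ x < n, E c x ≤ n)
    (hM : PartialAssignment n k E own col 0 0) (hρ : col ρ = 0) {h i : ℕ}
    (hF : Fixed n k E own col ρ fl σ) (hS : SearchInv n k E own col ρ h i σ)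
    (hcc : σ.var 12 ≠ 0) :
    LeadsIn n k W I (augmentCost n k) (augment k) (fun σ' => Ready n k σ' ∧ σ'.arr 0 = E ∧
      σ'.var 6 = ρ ∧ σ'.var 17 = fl ∧ PartialAssignment n k E (σ'.arr 1) (σ'.arr 3 0) 0 0 ∧
      σ'.arr 3 0 ρ ≠ 0 ∧ (∀ x, col x ≠ 0 → σ'.arr 3 0 x ≠ 0) ∧
      ∀ x ≠ ρ, col x = 0 → σ'.arr 3 0 x = 0) σ := by
  have S : Search n k E own col ρ (σ.arr 4 0) (σ.arr 2) (σ.var 11) (σ.var 12) (σ.var 13) h i := hS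
  have htail := S.tail_le
  refine (LeadsIn.loop (by norm_num) (by norm_num)
    (AugmentInv n k E col ρ fl (σ.arr 4 0) (σ.arr 2) (σ.var 11)) ?_ ?_ (σ.var 11)
    (T := (augmentStep k).cost) ?_).mono (T := σ.var 11 * ((augmentStep k).cost + 1) + 1) ?_
    (fun _ h => h)
  · intro m τ hτ hlt
    rw [hτ.ready.zero_eq] at hlt
    obtain ⟨m', hm, hL⟩ := leads_augmentStep hW hE hM hρ S hτ (I := I) (by omega)
    exact ⟨m', hm, hL.leadsIn (by simp [augmentStep])⟩
  · intro m τ hτ hlt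
    rw [hτ.ready.zero_eq] at hlt
    have h12 : τ.var 12 = 0 := by omega
    have A := hτ.augmentation
    rw [h12] at A
    exact ⟨hτ.ready, hτ.offer, hτ.root, hτ.fail, A.assignment.of_zero 0, A.root rfl, A.mono,
      A.frame⟩
  · refine ⟨hF.ready, hF.offer, rfl, hF.root, hF.fail, ?_⟩
    rw [hF.own, hF.col]
    exact Augmentation.start hM S hcc
  · have := Nat.mul_le_mul_right ((augmentStep k).cost + 1) htail
    unfold augmentCost
    omega

/-! ### The main loop -/

def enqueueRoot (k : ℕ) : Prog :=
  .seq (setArr k 4 (.const 0) (.const 0) (.var 6)) <| .seq (setVar k 10 (.const 0)) <|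
  .seq (setVar k 11 (.const 1)) (setVar k 12 (.const 0))

/-- A failed search only raises the flag in variable 17 and leaves the assignment as it was; later
phases run regardless, since the flag alone settles the answer. -/
def phase (k : ℕ) : Prog :=
  .seq (clearParents k) <| .seq (enqueueRoot k) <| .seq (search k) <|
  .branch (.eq 12 1) (setVar k 17 (.const 1)) (augment k)

def phaseCost (n k : ℕ) : ℕ :=
  clearParentsCost n k + ((enqueueRoot k).cost + (searchCost n k +
    (1 + ((setVar k 17 (.const 1)).cost + augmentCost n k))))

/-- The invariant of the main loop, after the searches from the vertices before `i`. -/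
structure PhaseInv (n k : ℕ) (E : ℕ → ℕ → ℕ) (i : ℕ) (σ : View) : Prop where
  ready : Ready n k σ
  offer : σ.arr 0 = E
  assignment : PartialAssignment n k E (σ.arr 1) (σ.arr 3 0) 0 0
  fail_le : σ.var 17 ≤ 1
  colored : σ.var 17 = 0 → ∀ x < i, σ.arr 3 0 x ≠ 0
  failed : σ.var 17 ≠ 0 → ¬ HasTransversal n k E
  uncolored : ∀ x, i ≤ x → σ.arr 3 0 x = 0

theorem PhaseInv.setVar {i : ℕ} (h : PhaseInv n k E i σ) {d x : ℕ} (hd : 4 < d) (hd' : d ≠ 17) :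
    PhaseInv n k E i (σ.setVar d x) := by
  have h17 : (σ.setVar d x).var 17 = σ.var 17 := by simp [hd'.symm]
  exact ⟨h.ready.setVar hd, h.offer, h.assignment, by rw [h17]; exact h.fail_le,
    by rw [h17]; exact h.colored, by rw [h17]; exact h.failed, h.uncolored⟩

theorem leads_phase (hW : LargeWord n k W) (hk : 0 < k) (hE : ∀ c < k, ∀ x < n, E c x ≤ n)
    {i : ℕ} (hi : i < n) (hσ : PhaseInv n k E i σ) (h6 : σ.var 6 = i) :
    LeadsIn n k W I (phaseCost n k) (phase k)
      (fun σ' => σ'.var 6 = i ∧ PhaseInv n k E (i + 1) σ') σ := by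
  have hWn : n + k + 1 ≤ W := hW.le_of_le (by have := Nat.le_mul_self n; omega)
  have hM := hσ.assignment
  have hρ := hσ.uncolored i le_rfl
  have hF : Fixed n k E (σ.arr 1) (σ.arr 3 0) i (σ.var 17) σ :=
    ⟨hσ.ready, hσ.offer, rfl, rfl, h6, rfl⟩
  refine LeadsIn.seq ((leads_clearParents hW hF).mono le_rfl ?_)
  rintro σ₁ ⟨hF₁, hpar⟩
  refine LeadsIn.seq (Leads.leadsIn (by simp [enqueueRoot]) (Leads.seq (Leads.setArr hW
    (by norm_num) ?_ ?_ ?_ ?_ ?_ (Leads.seq (Leads.setVar hW (by norm_num) ?_ (Leads.seq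
    (Leads.setVar hW (by norm_num) ?_ (Leads.setVar hW (by norm_num) ?_ ?_))))))))
  · simp
  · simp
  · simp [hF₁.root]; omega
  · simpa using hk
  · simp
  · simp
  · simp; omega
  · simp
  refine LeadsIn.seq ((leads_search hW hk hE hM hρ
    ((((hF₁.setArr (by norm_num)).setVar ?_ ?_ ?_).setVar ?_ ?_ ?_).setVar ?_ ?_ ?_) ?_ ?_).mono
    le_rfl ?_)
  iterate 9 norm_num
  · unfold SearchInv
    simp only [View.setVar_var, View.setVar_arr, View.setArr_arr, View.setArr_var, eval]
    norm_num
    exact Search.start _ hi (by simp [hF₁.root]) hpar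
  · simp
  rintro σ₂ ⟨hF₂, h, hh, hS⟩
  have S : Search n k E (σ.arr 1) (σ.arr 3 0) i (σ₂.arr 4 0) (σ₂.arr 2) (σ₂.var 11) (σ₂.var 12)
    (σ₂.var 13) h 0 := hS
  refine LeadsIn.branch (by norm_num) (by norm_num) (fun h12 => Leads.leadsIn
    (loopFree_setVar _ _ _) (Leads.setVar hW (by norm_num) ?_ ?_)) fun h12 => ?_
  · simp; omega
  · rw [hF₂.ready.zero_eq] at h12
    rw [h12] at S
    refine ⟨by simpa using hF₂.root, ?_⟩
    constructor
    · exact hF₂.ready.setVar (by norm_num)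
    · exact hF₂.offer
    · simpa only [View.setVar_arr, hF₂.own, hF₂.col] using hM
    · simp
    · simp
    · exact fun _ => S.not_hasTransversal hE hM hρ hh
    · intro x hx
      simpa only [View.setVar_arr, hF₂.col] using hσ.uncolored x (by omega)
  · rw [hF₂.ready.zero_eq] at h12
    refine (leads_augment hW hE hM hρ hF₂ hS h12).mono le_rfl ?_
    rintro τ ⟨hR, h0, h6, h17, hM', hroot, hmono, hframe⟩
    refine ⟨h6, hR, h0, hM', by rw [h17]; exact hσ.fail_le, ?_, by rw [h17]; exact hσ.failed, ?_⟩
    · intro hfl x hx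
      rcases Nat.lt_succ_iff_lt_or_eq.mp hx with hx | rfl
      · exact hmono x (hσ.colored (by omega) x hx)
      · exact hroot
    · intro x hx
      exact hframe x (by omega) (hσ.uncolored x (by omega))

def assignAll (k : ℕ) : Prog :=
  .seq (forLoop k 6 0 (phase k)) (setVar k 0 (.sub (.const 1) (.var 17)))

def assignAllCost (n k : ℕ) : ℕ :=
  forCost k 6 n (phaseCost n k) + (setVar k 0 (.sub (.const 1) (.var 17))).cost

theorem leads_assignAll (hW : LargeWord n k W) (hk : 0 < k) (hE : ∀ c < k, ∀ x < n, E c x ≤ n)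
    (hσ : PhaseInv n k E 0 σ) :
    LeadsIn n k W I (assignAllCost n k) (assignAll k) (fun σ' =>
      (HasTransversal n k E → σ'.var 0 = 1) ∧ (¬ HasTransversal n k E → σ'.var 0 = 0)) σ := by
  have hWn : n + k + 1 ≤ W := hW.le_of_le (by have := Nat.le_mul_self n; omega)
  refine LeadsIn.seq (LeadsIn.forLoop hW (by norm_num) (by norm_num) (by omega) (PhaseInv n k E)
    (fun _ _ h => h.ready.n_eq) ?_ ?_ (hσ.setVar (by norm_num) (by norm_num)))
  · intro i σ hi hσ h6
    refine (leads_phase hW hk hE hi hσ h6).mono le_rfl ?_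
    rintro τ ⟨h6, hτ⟩
    exact ⟨h6, hτ.setVar (by norm_num) (by norm_num)⟩
  · intro σ hσ
    have h1 := hσ.fail_le
    refine Leads.leadsIn (loopFree_setVar _ _ _) (Leads.setVar hW (by norm_num) ?_ ?_)
    · simp; omega
    simp only [eval, View.setVar_var, if_true]
    constructor
    · intro hT
      have : σ.var 17 = 0 := by
        by_contra h
        exact hσ.failed h hT
      omega
    · intro hT
      have : σ.var 17 ≠ 0 := fun h => hT (hσ.assignment.hasTransversal (hσ.colored h))
      omega

end

end RAM

/-! ## List colorings as transversals -/

namespace ListColoring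

open RAM Transversal

/-- Color `c` is in the list of the vertex `v`. -/
def InList {n k : ℕ} (L : Fin n → Finset (Fin k)) (c v : ℕ) : Prop :=
  ∃ (hc : c < k) (hv : v < n), (⟨c, hc⟩ : Fin k) ∈ L ⟨v, hv⟩

/-- Adjacency of vertices given by their numbers. -/
def AdjNat {n : ℕ} (G : SimpleGraph (Fin n)) (v u : ℕ) : Prop :=
  ∃ (hv : v < n) (hu : u < n), G.Adj ⟨v, hv⟩ ⟨u, hu⟩

theorem induce_iso_pathGraph {V : Type*} {G : SimpleGraph V} {x y z : V} (hxy : G.Adj x y)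
    (hyz : G.Adj y z) (hne : x ≠ z) (hxz : ¬ G.Adj x z) :
    Nonempty (G.induce {x, y, z} ≃g SimpleGraph.pathGraph 3) := by
  have hzx : ¬ G.Adj z x := fun h => hxz h.symm
  let f : Fin 3 → ({x, y, z} : Set V) := ![⟨x, by simp⟩, ⟨y, by simp⟩, ⟨z, by simp⟩]
  have hf : Function.Bijective f := by
    constructor
    · intro i j hij
      fin_cases i <;> fin_cases j <;>
        simp_all [f, hxy.ne, hyz.ne, hxy.ne', hyz.ne', hne.symm]
    · rintro ⟨w, rfl | rfl | rfl⟩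
      exacts [⟨0, rfl⟩, ⟨1, rfl⟩, ⟨2, rfl⟩]
  refine ⟨SimpleGraph.Iso.symm ⟨Equiv.ofBijective f hf, ?_⟩⟩
  intro i j
  simp only [Equiv.ofBijective_apply, SimpleGraph.induce_adj, SimpleGraph.pathGraph_adj]
  fin_cases i <;> fin_cases j <;> simp [f, hxy, hyz, hxy.symm, hyz.symm, hxz, hzx]

/-- The vertices whose lists contain a given color induce a disjoint union of cliques. -/
theorem adj_trans {V : Type*} {k : ℕ} {G : SimpleGraph V} {L : V → Finset (Fin k)}
    (hL : NoMonochromaticP3 G L) {c : Fin k} {x y z : V} (hx : c ∈ L x) (hy : c ∈ L y)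
    (hz : c ∈ L z) (hxy : G.Adj x y) (hyz : G.Adj y z) (hne : x ≠ z) : G.Adj x z := by
  by_contra hxz
  have h := hL x y z (induce_iso_pathGraph hxy hyz hne hxz)
  exact absurd (Finset.mem_inter.mpr ⟨Finset.mem_inter.mpr ⟨hx, hy⟩, hz⟩) (by rw [h]; simp)

theorem lastSucc_le (P : ℕ → Prop) (m : ℕ) : lastSucc P m ≤ m := by
  induction m with
  | zero => exact le_rfl
  | succ m ih => rw [lastSucc]; split_ifs <;> omega

theorem lastSucc_spec {P : ℕ → Prop} {m u : ℕ} (h : lastSucc P m = u + 1) : P u := by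
  induction m with
  | zero => simp [lastSucc] at h
  | succ m ih =>
    rw [lastSucc] at h
    split_ifs at h with hm
    · obtain rfl : m = u := by omega
      exact hm
    · exact ih h

theorem lastSucc_ne_zero {P : ℕ → Prop} {m u : ℕ} (hu : u < m) (h : P u) : lastSucc P m ≠ 0 := by
  induction m with
  | zero => omega
  | succ m ih =>
    rw [lastSucc]
    split_ifs with hm
    · omega
    · refine ih (lt_of_le_of_ne (by omega) ?_)
      rintro rfl
      exact hm h

variable {n k : ℕ} {G : SimpleGraph (Fin n)} {L : Fin n → Finset (Fin k)}

/-- Adjacency or equality is an equivalence relation on the vertices that have c in their lists; its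
classes are the cliques. -/
theorem adjNat_trans (hL : NoMonochromaticP3 G L) {c x y z : ℕ} (hx : InList L c x)
    (hy : InList L c y) (hz : InList L c z) (hxy : AdjNat G x y ∨ x = y)
    (hyz : AdjNat G y z ∨ y = z) : AdjNat G x z ∨ x = z := by
  rcases hxy with ⟨hxn, hyn, hxy⟩ | rfl
  · rcases hyz with ⟨_, hzn, hyz⟩ | rfl
    · by_cases hxz : x = z
      · exact Or.inr hxz
      · obtain ⟨hc, _, hx⟩ := hx
        obtain ⟨_, _, hy⟩ := hy
        obtain ⟨_, _, hz⟩ := hz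
        exact Or.inl ⟨hxn, hzn, adj_trans hL hx hy hz hxy hyz (by simpa using hxz)⟩
    · exact Or.inl ⟨hxn, hyn, hxy⟩
  · exact hyz

theorem adjNat_symm {x y : ℕ} (h : AdjNat G x y ∨ x = y) : AdjNat G y x ∨ y = x :=
  h.imp (fun ⟨hx, hy, h⟩ => ⟨hy, hx, h.symm⟩) Eq.symm

/-- List colorings are transversals of the cliques. -/
theorem admissible_iff (hL : NoMonochromaticP3 G L) {E : ℕ → ℕ → ℕ}
    (hE : ∀ c < k, ∀ v < n, E c v = lastSucc (Candidate (InList L) (AdjNat G) c v) n) :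
    Admissible G L ↔ HasTransversal n k E := by
  constructor
  · rintro ⟨φ, hφ⟩
    let f : ℕ → ℕ := fun x => if hx : x < n then φ ⟨x, hx⟩ else 0
    have hf : ∀ x (hx : x < n), f x = φ ⟨x, hx⟩ := fun x hx => dif_pos hx
    have hfk : ∀ x < n, f x < k := fun x hx => by rw [hf x hx]; exact (φ ⟨x, hx⟩).2
    have hfL : ∀ x < n, InList L (f x) x := fun x hx =>
      ⟨hfk x hx, hx, by simpa only [hf x hx] using hφ ⟨x, hx⟩⟩
    have hne : ∀ x < n, E (f x) x ≠ 0 := fun x hx => by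
      rw [hE _ (hfk x hx) _ hx]
      -- A vertex is a candidate for its own clique, so every color in its list yields an offer.
      exact lastSucc_ne_zero hx ⟨hfL x hx, hfL x hx, Or.inr rfl⟩
    refine ⟨f, fun x hx => ⟨hfk x hx, hne x hx⟩, fun x hx y hy hxy hEE => ?_⟩
    obtain ⟨u, hu⟩ := Nat.exists_eq_succ_of_ne_zero (hne x hx)
    have h1 := hu
    have h2 := hEE ▸ hu
    rw [hE _ (hfk x hx) _ hx] at h1
    rw [hE _ (hfk y hy) _ hy] at h2
    obtain ⟨h3, h4, h5⟩ := lastSucc_spec h1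
    obtain ⟨h6, h7, h8⟩ := lastSucc_spec h2
    -- Equal slots have a common representative u, through which x and y are adjacent or equal;
    -- being of one color, they are equal.
    rw [← hxy] at h6
    rcases adjNat_trans hL h3 h4 h6 h5 (adjNat_symm h8) with ⟨_, _, h⟩ | h
    · have h9 := φ.valid h
      rw [hf x hx, hf y hy] at hxy
      exact absurd (Fin.ext hxy) h9
    · exact h
  · rintro ⟨f, hf, hinj⟩
    have hfL : ∀ x < n, InList L (f x) x := fun x hx => by
      obtain ⟨h1, h2⟩ := hf x hx
      rw [hE _ h1 _ hx] at h2
      obtain ⟨u, hu⟩ := Nat.exists_eq_succ_of_ne_zero h2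
      exact (lastSucc_spec hu).1
    refine ⟨SimpleGraph.Coloring.mk (fun v => ⟨f v, (hf v v.2).1⟩) ?_, fun v => (hfL v v.2).2.2⟩
    intro x y hxy hcol
    have hcol' : f x = f y := by simpa using hcol
    have hx := hfL x x.2
    have hy := hfL y y.2
    rw [← hcol'] at hy
    have hadj : AdjNat G x y ∨ (x : ℕ) = y := Or.inl ⟨x.2, y.2, hxy⟩
    -- Adjacent vertices that share the color have the same candidates, hence the same slot, which
    -- contradicts distinctness.
    have hcand : Candidate (InList L) (AdjNat G) (f x) x =
        Candidate (InList L) (AdjNat G) (f x) y := by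
      funext u
      refine propext ⟨?_, ?_⟩
      · rintro ⟨-, h2, h3⟩
        exact ⟨hy, h2, adjNat_trans hL hy hx h2 (adjNat_symm hadj) h3⟩
      · rintro ⟨-, h2, h3⟩
        exact ⟨hx, h2, adjNat_trans hL hx hy h2 hadj h3⟩
    refine hxy.ne (Fin.ext (hinj x x.2 y y.2 hcol' ?_))
    rw [← hcol', hE _ (hf x x.2).1 _ x.2, hE _ (hf x x.2).1 _ y.2, hcand]

/-! ### Reading the input from memory. -/

open Classical in
theorem encodes_input (G : SimpleGraph (Fin n)) (L : Fin n → Finset (Fin k)) :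
    Encodes n k (input G L).mem (InList L) (AdjNat G) where
  list v hv c hc := by
    refine if_congr ⟨?_, fun ⟨_, _, h⟩ => Or.inr ⟨⟨v, hv⟩, ⟨c, hc⟩, rfl, h⟩⟩ rfl rfl
    -- Adjacency entries lie below n², so a list cell cannot be one of them.
    rintro (⟨u, w, h, -⟩ | ⟨w, i, h, hi⟩)
    · have := mul_add_lt u.2 w.2
      omega
    · obtain ⟨h1, h2⟩ := mul_add_inj hc i.2 (Nat.add_left_cancel h)
      subst h1 h2
      exact ⟨hc, hv, hi⟩
  adj v hv u hu := by
    have hlt := mul_add_lt hv hu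
    refine if_congr ⟨?_, fun ⟨_, _, h⟩ => Or.inl ⟨⟨v, hv⟩, ⟨u, hu⟩, rfl, h⟩⟩ rfl rfl
    rintro (⟨x, w, h, hi⟩ | ⟨w, i, h, -⟩)
    · obtain ⟨h1, h2⟩ := mul_add_inj hu w.2 h
      subst h1 h2
      exact ⟨hv, hu, hi⟩
    · omega

theorem input_mem_of_base_le (G : SimpleGraph (Fin n)) (L : Fin n → Finset (Fin k)) {a : ℕ}
    (ha : base n k ≤ a) : (input G L).mem a = 0 := by
  refine if_neg ?_
  unfold base at ha
  rintro (⟨u, w, h, -⟩ | ⟨w, i, h, -⟩)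
  · have := mul_add_lt u.2 w.2
    omega
  · have := mul_add_lt w.2 i.2
    omega

/-! ## The complete program -/

def constants (k : ℕ) : Prog :=
  .seq (setVar k 2 (.const 1)) <| .seq (setVar k 3 (.const k))
    (setVar k 4 (.add (.var 0) (.const 1)))

def decideColoring (k : ℕ) : Prog := .seq (constants k) (.seq (offers k) (assignAll k))

def decideColoringCost (n k : ℕ) : ℕ :=
  (constants k).cost + (offersCost n k + assignAllCost n k)

/-- Puts the address of the first cell after the input into register `20`. -/
def computeBase (k : ℕ) : Prog :=
  .seq (.instr (.const 20 k)) <| .seq (.instr (.mul 20 0 20)) <| .seq (.instr (.mul 21 0 0))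
    (.instr (.add 20 21 20))

/-- The view of the initial state. -/
def initialView (n : ℕ) : View where
  var i := if i = 0 then n else 0
  arr _ _ _ := 0

theorem exec_computeBase {W : ℕ} (hW : LargeWord n k W) (G : SimpleGraph (Fin n))
    (L : Fin n → Finset (Fin k)) :
    ∃ s, Exec W (computeBase k) (input G L) 4 s ∧
      Represents n k (input G L).mem (initialView n) s := by
  have h1 : k ≤ W := hW.le_of_le (by omega)
  have h2 : n * n + n * k ≤ W := hW.le_of_le (by omega)
  refine ⟨_, .seq (.instr _ _ ?_) (.seq (.instr _ _ ?_) (.seq (.instr _ _ ?_) (.instr _ _ ?_))),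
    ?_, ?_, ?_, ?_⟩
  · simpa [Instr.value] using h1
  · simp [Instr.value, Instr.apply, input]; omega
  · simp [Instr.value, Instr.apply, input]; omega
  · simp [Instr.value, Instr.apply, input]; omega
  · intro i hi
    simp [Instr.apply, show i ≠ 20 by omega, show i ≠ 21 by omega, input,
      initialView]
  · simp [Instr.value, Instr.apply, input, base]
  · intro a _
    simp [Instr.apply]
  · intro j _ c _ a
    exact input_mem_of_base_le G L (by unfold address; omega)

theorem leads_decideColoring {W : ℕ} (hW : LargeWord n k W) (hk : 0 < k)
    (hL : NoMonochromaticP3 G L) :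
    LeadsIn n k W (input G L).mem (decideColoringCost n k) (decideColoring k) (fun σ =>
      (Admissible G L → σ.var 0 = 1) ∧ (¬ Admissible G L → σ.var 0 = 0)) (initialView n) := by
  have hWn : n + k + 1 ≤ W := hW.le_of_le (by have := Nat.le_mul_self n; omega)
  refine LeadsIn.seq (Leads.leadsIn (by simp [constants]) (Leads.seq (Leads.setVar hW (by norm_num)
    ?_ (Leads.seq (Leads.setVar hW (by norm_num) ?_ (Leads.setVar hW (by norm_num) ?_ ?_))))))
  · simp; omega
  · simp; omega
  · simp [initialView]; omega
  refine LeadsIn.seq ((leads_offers hW (encodes_input G L) ⟨?_, ?_, ?_, ?_⟩).mono le_rfl ?_)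
  · constructor <;> simp [initialView]
  · intro j _
    simp [initialView]
  · intro c _ v _ h
    omega
  · simp [initialView]
  intro σ hσ
  have hE : ∀ c < k, ∀ v < n, σ.arr 0 c v =
      lastSucc (Candidate (InList L) (AdjNat G) c v) n :=
    fun c hc v hv => hσ.offer c hc v hv (Or.inl hc)
  rw [admissible_iff hL hE]
  refine leads_assignAll hW hk (fun c hc x hx => by rw [hE c hc x hx]; exact lastSucc_le _ _) ?_
  have h1 := hσ.arr 1 (by norm_num)
  have h3 := hσ.arr 3 (by norm_num)
  -- Memory that is still zero represents the empty assignment.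
  refine ⟨hσ.ready, rfl, ⟨?_, ?_, ?_⟩, ?_, ?_, ?_, ?_⟩ <;> simp [h1, h3, hσ.fail]

/-! ### The running time -/

/-- The function `f` grows at most like `n ^ d`. -/
def PolyBounded (d : ℕ) (f : ℕ → ℕ) : Prop := ∃ C, ∀ n, 1 ≤ n → f n ≤ C * n ^ d

theorem PolyBounded.const (d c : ℕ) : PolyBounded d fun _ => c :=
  ⟨c, fun _ hn => Nat.le_mul_of_pos_right c (Nat.pow_pos hn)⟩

theorem PolyBounded.add {d : ℕ} {f g : ℕ → ℕ} (hf : PolyBounded d f) (hg : PolyBounded d g) :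
    PolyBounded d fun n => f n + g n := by
  obtain ⟨C, hC⟩ := hf
  obtain ⟨D, hD⟩ := hg
  exact ⟨C + D, fun n hn => by rw [Nat.add_mul]; exact Nat.add_le_add (hC n hn) (hD n hn)⟩

theorem PolyBounded.mul {d e : ℕ} {f g : ℕ → ℕ} (hf : PolyBounded d f) (hg : PolyBounded e g) :
    PolyBounded (d + e) fun n => f n * g n := by
  obtain ⟨C, hC⟩ := hf
  obtain ⟨D, hD⟩ := hg
  refine ⟨C * D, fun n hn => (Nat.mul_le_mul (hC n hn) (hD n hn)).trans_eq ?_⟩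
  rw [pow_add]
  ring

theorem PolyBounded.id : PolyBounded 1 fun n => n := ⟨1, fun n _ => by simp⟩

theorem PolyBounded.forCost {k v d e : ℕ} {m T : ℕ → ℕ} (hm : PolyBounded d m)
    (hT : PolyBounded e T) : PolyBounded (d + e) fun n => forCost k v (m n) (T n) :=
  (const _ _).add ((hm.mul ((hT.add (const _ _)).add (const _ _))).add (const _ _))

/-- For fixed k the offers cost n² and each of the n phases is linear in n. -/
theorem polyBounded_decideColoringCost (k : ℕ) : PolyBounded 2 fun n => decideColoringCost n k := by
  have hoffers : PolyBounded 2 fun n => offersCost n k :=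
    (PolyBounded.const 0 k).forCost (e := 2) (PolyBounded.id.forCost (e := 1)
      ((PolyBounded.const 1 _).add (PolyBounded.id.forCost (e := 0) (PolyBounded.const 0 _))))
  have hclear : PolyBounded 1 fun n => clearParentsCost n k :=
    (PolyBounded.const 0 k).forCost (e := 1) ((PolyBounded.id.add (.const 1 1)).forCost (e := 0)
      (PolyBounded.const 0 _))
  have hsearch : PolyBounded 1 fun n => searchCost n k :=
    (PolyBounded.id.mul (PolyBounded.const 0 _)).add (.const 1 1)
  have haugment : PolyBounded 1 fun n => augmentCost n k :=
    (PolyBounded.id.mul (PolyBounded.const 0 _)).add (.const 1 1)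
  have hphase : PolyBounded 1 fun n => phaseCost n k :=
    hclear.add ((PolyBounded.const 1 _).add (hsearch.add
      ((PolyBounded.const 1 1).add ((PolyBounded.const 1 _).add haugment))))
  exact (PolyBounded.const 2 _).add (hoffers.add
    ((PolyBounded.id.forCost hphase).add (PolyBounded.const 2 _)))

/-- All addresses are at most (6k + 6)(n + 1)², and the constant factor is absorbed by (n + 1)^(6k +
6) because n + 1 ≥ 2. For fixed k such words have O(log n) bits. -/
theorem largeWord_pow {n : ℕ} (k : ℕ) (hn : 1 ≤ n) : LargeWord n k ((n + 1) ^ (6 * k + 8)) := by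
  have h1 : 6 * k + 6 ≤ (n + 1) ^ (6 * k + 6) :=
    (Nat.lt_pow_self (by omega : 1 < n + 1)).le
  have h2 : (n + 1) ^ (6 * k + 8) = (n + 1) ^ (6 * k + 6) * (n + 1) ^ 2 := by rw [← pow_add]
  have h3 := Nat.mul_le_mul_right ((n + 1) ^ 2) h1
  unfold LargeWord address base
  rw [h2]
  refine le_trans ?_ h3
  nlinarith [Nat.zero_le (n * k), Nat.zero_le (n * n * k), Nat.zero_le (n * n), Nat.zero_le k]

end ListColoring

theorem theorem2p1 (k r : ℕ) (hk : 1 ≤ k) (hr : 1 ≤ r) :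
    ∃ (p : RAM.Prog) (c : ℕ) (C : ℝ), ∀ (n : ℕ), 1 ≤ n →
      ∀ (G : SimpleGraph (Fin n)) (L : Fin n → Finset (Fin k)),
        IsFree G (rP3 r) → NoMonochromaticP3 G L →
          ∃ (t : ℕ) (s : RAM.State),
            RAM.Exec ((n + 1) ^ c) p (RAM.input G L) t s ∧
            (t : ℝ) ≤ C * (n : ℝ) ^ (5 / 2 : ℝ) ∧
            (Admissible G L → s.reg 0 = 1) ∧
            (¬ Admissible G L → s.reg 0 = 0) := by
  -- The 4 counts the steps of `computeBase`.
  obtain ⟨C, hC⟩ := (ListColoring.PolyBounded.const 2 4).add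
    (ListColoring.polyBounded_decideColoringCost k)
  refine ⟨.seq (ListColoring.computeBase k) (ListColoring.decideColoring k), 6 * k + 8, C, ?_⟩
  intro n hn G L _ hL
  have hW := ListColoring.largeWord_pow k hn
  obtain ⟨s₁, h₁, hs₁⟩ := ListColoring.exec_computeBase hW G L
  obtain ⟨t, s, σ, h₂, ht, hs, h1, h0⟩ := ListColoring.leads_decideColoring hW hk hL s₁ hs₁
  have hreg : s.reg 0 = σ.var 0 := hs.var 0 (by norm_num)
  refine ⟨4 + t, s, .seq h₁ h₂, ?_, by rwa [hreg], by rwa [hreg]⟩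
  have hn' : (1 : ℝ) ≤ n := by exact_mod_cast hn
  have hnat : 4 + t ≤ C * n ^ 2 := (Nat.add_le_add_left ht 4).trans (hC n hn)
  calc ((4 + t : ℕ) : ℝ) ≤ ((C * n ^ 2 : ℕ) : ℝ) := by exact_mod_cast hnat
    _ = C * (n : ℝ) ^ (2 : ℝ) := by push_cast; rw [Real.rpow_two]
    _ ≤ C * (n : ℝ) ^ (5 / 2 : ℝ) := by
      gcongr
      norm_num
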